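/- For an integer $n\ge 1$ and an even integer $k\ge 2$, a $k$-uniform hypergraph on $[n]$ is a set $H\subseteq\binom{[n]}{k}$; a set $S\subseteq[n]$ is a clique in $H$ if every $k$-element subset of $S$ belongs to $H$ (so sets with fewer than $k$ elements are cliques), and $\omega(H)$ is the largest size of a clique. $\mathcal H(k,n,p)$ denotes the random hypergraph containing each $C\in\binom{[n]}{k}$ independently with probability $p$. For $C\in\binom{[n]}{k}$ let $A_C$ be the $\binom{n}{k/2}\times\binom{n}{k/2}$ real matrix, indexed by the $k/2$-element subsets of $[n]$, with $A_C(S,T)=1$ if $S\cup T=C$ and $A_C(S,T)=0$ otherwise. For a hypergraph $H$ and $p\in[0,1]$ let $A=\sum_{C\in\binom{[n]}{k}} b_C A_C$, where $b_C=1-p$ if $C\in H$ and $b_C=-p$ otherwise, and for $p<1$ let $$\omega_{\mathrm{spec}}(H)=\max\left(k-1,\; k\left(\frac{1}{(1-p)^2}\binom{k}{k/2}\|A\|_2^2\right)^{1/k}\right).$$ There is an algorithm (a program for a real random access machine, that is, a machine doing exact real arithmetic operations and comparisons at unit cost) that takes as input $n$, $k$, $p\in[0,1]$ and a $k$-uniform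 hypergraph $H$ on $[n]$ (given by its adjacency tensor) and outputs, in $n^{O(k)}$ steps, the integer $\omega_{\mathrm{alg}}(H)=\min(n,\lfloor\omega_{\mathrm{spec}}(H)\rfloor)\in[0,n]$ if $p<1$, and $\omega_{\mathrm{alg}}(H)=n$ if $p=1$. Here $n^{O(k)}$ means at most $a\,n^{ak}$ for an absolute constant $a$. Moreover: 1. (Completeness) $\omega(H)\le\omega_{\mathrm{alg}}(H)$ for every $H\subseteq\binom{[n]}{k}$; if $p<1$, then also $\omega(H)\le\omega_{\mathrm{spec}}(H)$. 2. (High probability bound) There is an absolute constant $K$ such that, if $p<1$ and $H\sim\mathcal H(k,n,p)$, then for every real $c\ge 1$, with probability at least $1-n^{-c}$, both $\omega_{\mathrm{alg}}(H)$ and $\omega_{\mathrm{spec}}(H)$ are at most $$K\,k\left(\frac{c\log n}{1-p}\right)^{2/k}\sqrt n .$$ -/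

import Mathlib

namespace CliqueCert

/-! ### Uniform hypergraphs and cliques -/

/-- The set `[n] choose m` of all subsets of `[n]` with exactly `m` elements. -/
abbrev KSubset (n m : ℕ) : Type := {C : Finset (Fin n) // C.card = m}

/-- A `k`-uniform hypergraph on `[n]`, given by its set of hyperedges `H ⊆ [n] choose k`. -/
abbrev UHypergraph (k n : ℕ) : Type := Set (KSubset n k)

/-- `S` is a clique in `H` if every `k`-element subset of `S` is a hyperedge
(so every `S` with fewer than `k` elements is a clique). -/
def IsClique {k n : ℕ} (H : UHypergraph k n) (S : Finset (Fin n)) : Prop :=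
  ∀ C : KSubset n k, C.1 ⊆ S → C ∈ H

open Classical in
/-- The clique number `ω(H)`: the largest size of a clique. -/
noncomputable def cliqueNumber {k n : ℕ} (H : UHypergraph k n) : ℕ :=
  (Finset.univ.filter fun S : Finset (Fin n) => IsClique H S).sup Finset.card

/-- The distribution `H(k,n,p)`: each of the `k`-element subsets of `[n]` is a hyperedge
with probability `p`, independently. -/
noncomputable def randomHypergraph (k n : ℕ) (p : unitInterval) :
    MeasureTheory.Measure (UHypergraph k n) :=
  ProbabilityTheory.setBernoulli Set.univ p

/-! ### The matrix and the spectral bound -/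

/-- `A_C(S,T) = 1` if `S ∪ T = C`, and `0` otherwise, for `S, T ∈ [n] choose k/2`. -/
def edgeMatrix {k n : ℕ} (C : KSubset n k) :
    Matrix (KSubset n (k / 2)) (KSubset n (k / 2)) ℝ :=
  Matrix.of fun S T => if S.1 ∪ T.1 = C.1 then 1 else 0

open Classical in
/-- `b_C = 1 - p` if `C ∈ H`, and `b_C = -p` otherwise. -/
noncomputable def edgeWeight {k n : ℕ} (H : UHypergraph k n) (p : ℝ) (C : KSubset n k) : ℝ :=
  if C ∈ H then 1 - p else -p

/-- `A = ∑_C b_C A_C`. -/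
noncomputable def spectralMatrix {k n : ℕ} (H : UHypergraph k n) (p : ℝ) :
    Matrix (KSubset n (k / 2)) (KSubset n (k / 2)) ℝ :=
  ∑ C : KSubset n k, edgeWeight H p C • edgeMatrix C

/-- The spectral norm `‖A‖₂`. -/
noncomputable def spectralNorm {k n : ℕ} (H : UHypergraph k n) (p : ℝ) : ℝ :=
  ‖Matrix.toEuclideanCLM (𝕜 := ℝ) (spectralMatrix H p)‖

/-- The value `max (k - 1, k ((1-p)⁻² (k choose k/2) ‖A‖₂²)^{1/k})`, meant for `p < 1`. -/
noncomputable def spectralBound {k n : ℕ} (H : UHypergraph k n) (p : ℝ) : ℝ :=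
  max ((k : ℝ) - 1)
    ((k : ℝ) * (1 / (1 - p) ^ 2 * (k.choose (k / 2) : ℝ) * spectralNorm H p ^ 2) ^ (1 / (k : ℝ)))

open Classical in
/-- The output of the algorithm: the integer part of the spectral bound, capped at the trivial
bound `n`. For `p = 1`, where the spectral bound is undefined, it is the trivial bound `n`. -/
noncomputable def algOutput {k n : ℕ} (H : UHypergraph k n) (p : ℝ) : ℕ :=
  if p = 1 then n else min n ⌊spectralBound H p⌋₊

/-! ### The machine model

A real random access machine with named variables and named arrays, programmed in a structured
language. Real numbers are manipulated exactly by the four arithmetic operations and comparisons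
at unit cost; there is no rounding, no root and no eigenvalue operation. Natural numbers serve as
counters and array indices and are manipulated by addition and truncated subtraction. -/

/-- Memory: natural-number variables and arrays, real variables and arrays. -/
structure State where
  nat : ℕ → ℕ
  natArr : ℕ → ℕ → ℕ
  real : ℕ → ℝ
  realArr : ℕ → ℕ → ℝ

/-- Elementary instructions; all arguments are names of variables (`x y z` natural, `r q s` real)
or of arrays (`a`), except for the constant `c`. -/
inductive Instr where
  | natConst (x c : ℕ)
  | natAdd (x y z : ℕ)
  | natSub (x y z : ℕ)
  | natLoad (x a y : ℕ)
  | natStore (a y x : ℕ)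
  | realOfNat (r x : ℕ)
  | realAdd (r q s : ℕ)
  | realSub (r q s : ℕ)
  | realMul (r q s : ℕ)
  | realDiv (r q s : ℕ)
  | realLoad (r a y : ℕ)
  | realStore (a y r : ℕ)

/-- `f` with the entry of index `i` of its row `a` replaced by `v`. -/
def setEntry {α : Type} (f : ℕ → ℕ → α) (a i : ℕ) (v : α) : ℕ → ℕ → α :=
  Function.update f a (Function.update (f a) i v)

open Classical in
/-- Effect of an instruction; a division by zero is an error. -/
noncomputable def Instr.exec : Instr → State → Option State
  | .natConst x c, m => some { m with nat := Function.update m.nat x c }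
  | .natAdd x y z, m => some { m with nat := Function.update m.nat x (m.nat y + m.nat z) }
  | .natSub x y z, m => some { m with nat := Function.update m.nat x (m.nat y - m.nat z) }
  | .natLoad x a y, m => some { m with nat := Function.update m.nat x (m.natArr a (m.nat y)) }
  | .natStore a y x, m => some { m with natArr := setEntry m.natArr a (m.nat y) (m.nat x) }
  | .realOfNat r x, m => some { m with real := Function.update m.real r (m.nat x : ℝ) }
  | .realAdd r q s, m => some { m with real := Function.update m.real r (m.real q + m.real s) }
  | .realSub r q s, m => some { m with real := Function.update m.real r (m.real q - m.real s) }
  | .realMul r q s, m => some { m with real := Function.update m.real r (m.real q * m.real s) }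
  | .realDiv r q s, m =>
      if m.real s = 0 then none
      else some { m with real := Function.update m.real r (m.real q / m.real s) }
  | .realLoad r a y, m => some { m with real := Function.update m.real r (m.realArr a (m.nat y)) }
  | .realStore a y r, m => some { m with realArr := setEntry m.realArr a (m.nat y) (m.real r) }

/-- Tests: strict comparison of two natural or of two real variables. -/
inductive Test where
  | natLt (x y : ℕ)
  | realLt (r q : ℕ)

/-- Outcome of a test. -/
def Test.Holds : Test → State → Prop
  | .natLt x y, m => m.nat x < m.nat y
  | .realLt r q, m => m.real r < m.real q

/-- Programs. -/
inductive Program where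
  | instr (i : Instr)
  | seq (P Q : Program)
  | ite (b : Test) (P Q : Program)
  | while (b : Test) (P : Program)

/-- `Runs P m t m'`: started in memory `m`, the program `P` halts in memory `m'` after exactly
`t` steps, where every elementary instruction and every test is one step. -/
inductive Runs : Program → State → ℕ → State → Prop where
  | instr {i : Instr} {m m' : State} : i.exec m = some m' → Runs (.instr i) m 1 m'
  | seq {P Q : Program} {m m' m'' : State} {t u : ℕ} :
      Runs P m t m' → Runs Q m' u m'' → Runs (.seq P Q) m (t + u) m''
  | iteTrue {b : Test} {P Q : Program} {m m' : State} {t : ℕ} :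
      b.Holds m → Runs P m t m' → Runs (.ite b P Q) m (t + 1) m'
  | iteFalse {b : Test} {P Q : Program} {m m' : State} {t : ℕ} :
      ¬ b.Holds m → Runs Q m t m' → Runs (.ite b P Q) m (t + 1) m'
  | whileTrue {b : Test} {P : Program} {m m' m'' : State} {t u : ℕ} :
      b.Holds m → Runs P m t m' → Runs (.while b P) m' u m'' →
        Runs (.while b P) m (t + u + 1) m''
  | whileFalse {b : Test} {P : Program} {m : State} :
      ¬ b.Holds m → Runs (.while b P) m 1 m

open Classical in
/-- The adjacency tensor of `H` as an array of length `n ^ k`: the entry at `∑ i, v i * n ^ i` is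
`1` if `v 0, …, v (k-1)` are the `k` distinct vertices of a hyperedge, and `0` otherwise. -/
noncomputable def edgeBit {k n : ℕ} (H : UHypergraph k n) (j : ℕ) : ℕ :=
  if ∃ v : Fin k → Fin n, j = ∑ i, (v i : ℕ) * n ^ (i : ℕ) ∧
      ∃ C ∈ H, C.1 = Finset.univ.image v then 1 else 0

/-- The input: `n` and `k` in the natural variables `0` and `1`, the number `p` in the real
variable `0`, the adjacency tensor in the natural array `0`; everything else is `0`. -/
noncomputable def inputState {k n : ℕ} (H : UHypergraph k n) (p : ℝ) : State where
  nat x := if x = 0 then n else if x = 1 then k else 0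
  natArr a j := if a = 0 then edgeBit H j else 0
  real r := if r = 0 then p else 0
  realArr _ _ := 0

end CliqueCert

/-!
The spectral matrix `A` has the entry `b_C` at `(S, T)` if `S` and `T` partition the `k`-set `C`, and
`0` at all pairs that meet. Three independent facts about its norm give the theorem.

*Completeness.* On the indicator vector of the `k/2`-subsets of a clique `S`, the matrix acts on the
coordinates inside `S` as multiplication by `(1 - p) * (|S| - k/2).choose (k/2)`
(`clique_le_spectralNorm`), and this binomial coefficient is at least `(|S| / k) ^ (k / 2)`.

*Concentration.* For `q` a power of two, `‖A‖ ^ q ≤ tr (A ^ q)`, and the trace is a sum over closed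
walks of products of edge weights. The weights are independent with mean zero and at most `1` in
absolute value, so only walks in which every edge is repeated contribute to the expectation. Such a
walk is determined by its start, by the map that sends a step to the first step with the same edge,
and by the end points of the at most `q / 2` steps that use a new edge, since a step from `S` along
`C` leads to `C \ S` (`card_walks_le`). The factor `q ^ q` for the first-occurrence map is crude, but
it only costs the difference between `log n` and its square root, which the claim concedes. Markov's
inequality with `q` about `2 * (k / 2 + c) * log n` finishes the argument
(`measure_spectralNorm_gt_le`).

*Computation.* The inequality `L ≤ spectralBound` for an integer `L ≥ k` says that a matrix of the
form `α * 1 - β * A²` is not positive definite (`le_spectralBound_iff`), with `α` and `β` obtained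
from `n`, `k`, `p` and `L` by ring operations. Symmetric elimination decides this exactly: a
symmetric matrix is positive definite if and only if all its pivots are positive
(`posDefFrom_zero_iff`), and multiplying by the positive pivot avoids divisions. The program indexes
the matrix by `k/2`-tuples instead of `k/2`-sets, since the adjacency tensor is given in this form.
The matrix of tuples is `P * A * Pᵀ`, where `P` is the incidence matrix between tuples and sets,
and since `Pᵀ * P = (k/2)! • 1`, its norm is `(k/2)!` times that of `A` (`blowUp_posDef_iff`).

The correctness and the running time of the program are proved with a small Hoare logic: `Achieves`
is total correctness with a time bound, `Achieves.forLoop` is the rule for counting loops, and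
`Frame` says that a program only changes the locations it writes to.
-/

namespace CliqueCert

/-! ### The Euclidean operator norm of a matrix -/

section OperatorNorm

variable {ι : Type*} [Fintype ι] [DecidableEq ι]

theorem sum_mulVec_sq_le (A : Matrix ι ι ℝ) (x : ι → ℝ) :
    ∑ i, A.mulVec x i ^ 2 ≤ ‖Matrix.toEuclideanCLM (𝕜 := ℝ) A‖ ^ 2 * ∑ i, x i ^ 2 := by
  have h := (Matrix.toEuclideanCLM (𝕜 := ℝ) A).le_opNorm (WithLp.toLp 2 x)
  have h2 := pow_le_pow_left₀ (norm_nonneg _) h 2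
  rw [mul_pow, EuclideanSpace.real_norm_sq_eq, EuclideanSpace.real_norm_sq_eq,
    Matrix.toEuclideanCLM_toLp] at h2
  exact h2

/-- In finite dimension the operator norm is attained. -/
theorem exists_norm_sq_mul_le_sum_mulVec_sq [Nonempty ι] (A : Matrix ι ι ℝ) :
    ∃ x : ι → ℝ, x ≠ 0 ∧
      ‖Matrix.toEuclideanCLM (𝕜 := ℝ) A‖ ^ 2 * ∑ i, x i ^ 2 ≤ ∑ i, A.mulVec x i ^ 2 := by
  set B := Matrix.toEuclideanCLM (𝕜 := ℝ) A with hB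
  have hne : (Metric.sphere (0 : EuclideanSpace ℝ ι) 1).Nonempty :=
    NormedSpace.sphere_nonempty.2 zero_le_one
  obtain ⟨x, hx, hmax⟩ := (isCompact_sphere (0 : EuclideanSpace ℝ ι) 1).exists_isMaxOn hne
    (f := fun x => ‖B x‖) (by fun_prop)
  have hx1 : ‖x‖ = 1 := by simpa using hx
  have hle : ‖B‖ ≤ ‖B x‖ := by
    refine B.opNorm_le_bound (norm_nonneg _) fun y => ?_
    rcases eq_or_ne y 0 with rfl | hy
    · simp
    have hy' : ‖y‖ ≠ 0 := norm_ne_zero_iff.2 hy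
    have := hmax (show (‖y‖⁻¹ • y) ∈ Metric.sphere (0 : EuclideanSpace ℝ ι) 1 by
      simp [norm_smul, hy'])
    simp only [Set.mem_ofPred_eq, map_smul, norm_smul, norm_inv, norm_norm] at this
    rwa [inv_mul_le_iff₀ (by positivity), mul_comm] at this
  refine ⟨x.ofLp, ?_, ?_⟩
  · intro h0
    have : x = 0 := by ext i; exact congrFun h0 i
    simp [this] at hx1
  · have h2 := pow_le_pow_left₀ (norm_nonneg _) hle 2
    rw [EuclideanSpace.real_norm_sq_eq (B x), hB, Matrix.ofLp_toEuclideanCLM] at h2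
    rw [← EuclideanSpace.real_norm_sq_eq x, hx1]
    simpa using h2

end OperatorNorm

/-! ### Entries of the spectral matrix -/

section Entries

variable {k n : ℕ}

theorem card_union_of_disjoint (hk : Even k) {S T : KSubset n (k / 2)} (h : Disjoint S.1 T.1) :
    (S.1 ∪ T.1).card = k := by
  rw [Finset.card_union_of_disjoint h, S.2, T.2]
  obtain ⟨r, rfl⟩ := hk
  omega

theorem disjoint_of_card_union (hk : Even k) {S T : KSubset n (k / 2)}
    (h : (S.1 ∪ T.1).card = k) : Disjoint S.1 T.1 := by
  rw [← Finset.card_union_eq_card_add_card, h, S.2, T.2]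
  obtain ⟨r, rfl⟩ := hk
  omega

theorem spectralMatrix_apply (H : UHypergraph k n) (p : ℝ) (S T : KSubset n (k / 2)) :
    spectralMatrix H p S T = ∑ C, edgeWeight H p C * if S.1 ∪ T.1 = C.1 then 1 else 0 := by
  simp [spectralMatrix, Matrix.sum_apply, edgeMatrix]

theorem spectralMatrix_apply_of_union_eq (H : UHypergraph k n) (p : ℝ) {S T : KSubset n (k / 2)}
    {C : KSubset n k} (h : S.1 ∪ T.1 = C.1) : spectralMatrix H p S T = edgeWeight H p C := by
  rw [spectralMatrix_apply, Finset.sum_eq_single C]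
  · simp [h]
  · intro C' _ hC'
    rw [if_neg, mul_zero]
    rw [h]
    exact fun h' => hC' (Subtype.ext h'.symm)
  · simp

theorem spectralMatrix_apply_of_not_disjoint (hk : Even k) (H : UHypergraph k n) (p : ℝ)
    {S T : KSubset n (k / 2)} (h : ¬ Disjoint S.1 T.1) : spectralMatrix H p S T = 0 := by
  rw [spectralMatrix_apply]
  refine Finset.sum_eq_zero fun C _ => ?_
  rw [if_neg, mul_zero]
  exact fun h' => h (disjoint_of_card_union hk (by rw [h', C.2]))

theorem spectralMatrix_transpose (H : UHypergraph k n) (p : ℝ) :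
    (spectralMatrix H p).transpose = spectralMatrix H p := by
  ext S T
  simp only [Matrix.transpose_apply, spectralMatrix_apply, Finset.union_comm]

theorem abs_edgeWeight_le_one (H : UHypergraph k n) (p : unitInterval) (C : KSubset n k) :
    |edgeWeight H (p : ℝ) C| ≤ 1 := by
  have := p.2.1
  have := p.2.2
  unfold edgeWeight
  rw [abs_le]
  split_ifs <;> constructor <;> linarith

end Entries

/-! ### Completeness -/

section Completeness

variable {k n : ℕ}

theorem card_filter_subset_disjoint {m : ℕ} (S T : Finset (Fin n)) :
    (Finset.univ.filter fun U : KSubset n m => U.1 ⊆ S ∧ Disjoint T U.1).card =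
      (S \ T).card.choose m := by
  rw [← Finset.card_powersetCard, ← Finset.card_map (Function.Embedding.subtype _)]
  congr 1
  ext U
  simp only [Finset.mem_map, Finset.mem_filter, Finset.mem_univ, true_and,
    Function.Embedding.subtype_apply, Subtype.exists, exists_and_right, exists_eq_right,
    Finset.mem_powersetCard, Finset.subset_sdiff, disjoint_comm (a := T)]
  constructor
  · rintro ⟨⟨hU, h⟩, hd⟩
    exact ⟨⟨h, hd⟩, hU⟩
  · rintro ⟨⟨h, hd⟩, hU⟩
    exact ⟨⟨hU, h⟩, hd⟩

/-- The indicator vector of the `k/2`-subsets of a clique `S` is multiplied by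
`(1 - p) * (|S| - k/2).choose (k/2)` at every `k/2`-subset of `S`. -/
theorem clique_le_spectralNorm (hk : Even k) (H : UHypergraph k n) {p : ℝ} {S : Finset (Fin n)}
    (hS : IsClique H S) (hkS : k ≤ S.card) :
    ((1 - p) * ((S.card - k / 2).choose (k / 2) : ℝ)) ^ 2 ≤ spectralNorm H p ^ 2 := by
  classical
  set x : KSubset n (k / 2) → ℝ := fun T => if T.1 ⊆ S then 1 else 0 with hx
  have key : ∀ T : KSubset n (k / 2), T.1 ⊆ S → (spectralMatrix H p).mulVec x T =
      (1 - p) * ((S.card - k / 2).choose (k / 2) : ℝ) := by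
    intro T hT
    have hterm : ∀ U : KSubset n (k / 2), spectralMatrix H p T U * x U =
        if U.1 ⊆ S ∧ Disjoint T.1 U.1 then 1 - p else 0 := by
      intro U
      by_cases hU : U.1 ⊆ S
      · by_cases hd : Disjoint T.1 U.1
        · rw [spectralMatrix_apply_of_union_eq H p (C := ⟨_, card_union_of_disjoint hk hd⟩) rfl]
          have : (⟨_, card_union_of_disjoint hk hd⟩ : KSubset n k) ∈ H :=
            hS _ (Finset.union_subset hT hU)
          simp [hx, hU, hd, edgeWeight, this]
        · simp [spectralMatrix_apply_of_not_disjoint hk H p hd, hd]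
      · simp [hx, hU]
    simp only [Matrix.mulVec, dotProduct, hterm, Finset.sum_ite, Finset.sum_const_zero, add_zero,
      Finset.sum_const, nsmul_eq_mul]
    rw [card_filter_subset_disjoint, Finset.card_sdiff_of_subset hT, T.2, mul_comm]
  have h1 := sum_mulVec_sq_le (spectralMatrix H p) x
  have h2 : ∑ T, x T ^ 2 = ((Finset.univ.filter fun T : KSubset n (k / 2) => T.1 ⊆ S).card : ℝ) := by
    simp [hx]
  have hpos : (0 : ℝ) < ((Finset.univ.filter fun T : KSubset n (k / 2) => T.1 ⊆ S).card : ℝ) := by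
    obtain ⟨T, hT, hc⟩ := Finset.exists_subset_card_eq (show k / 2 ≤ S.card by omega)
    have hT' : (⟨T, hc⟩ : KSubset n (k / 2)) ∈
        Finset.univ.filter fun T : KSubset n (k / 2) => T.1 ⊆ S := by simpa using hT
    exact_mod_cast Finset.card_pos.2 ⟨_, hT'⟩
  have h3 : ((Finset.univ.filter fun T : KSubset n (k / 2) => T.1 ⊆ S).card : ℝ) *
      ((1 - p) * ((S.card - k / 2).choose (k / 2) : ℝ)) ^ 2 ≤
      ∑ T, (spectralMatrix H p).mulVec x T ^ 2 := by
    rw [← nsmul_eq_mul, ← Finset.sum_const]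
    refine (Finset.sum_le_sum fun T hT => ?_).trans
      (Finset.sum_le_sum_of_subset_of_nonneg (Finset.filter_subset _ _) fun _ _ _ => sq_nonneg _)
    rw [key T (Finset.mem_filter.1 hT).2]
  rw [h2] at h1
  have h4 := h3.trans h1
  rw [mul_comm] at h4
  exact le_of_mul_le_mul_right h4 hpos

theorem div_pow_le_choose {r m : ℕ} (hr : r ≤ m) : ((m : ℝ) / r) ^ r ≤ (m.choose r : ℝ) := by
  induction r generalizing m with
  | zero => simp
  | succ r ih =>
    obtain ⟨m, rfl⟩ : ∃ m', m = m' + 1 := ⟨m - 1, by omega⟩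
    have hrm : (r : ℝ) ≤ m := by exact_mod_cast (by omega : r ≤ m)
    have h1 : ((m.succ : ℝ) / r.succ) ^ r ≤ (m.choose r : ℝ) := by
      refine le_trans ?_ (ih (by omega))
      rcases Nat.eq_zero_or_pos r with rfl | hr0
      · simp
      have : (0 : ℝ) < r := by exact_mod_cast hr0
      refine pow_le_pow_left₀ (by positivity) ?_ r
      push_cast
      rw [div_le_div_iff₀ (by positivity) this]
      nlinarith
    have h2 : ((m + 1).choose (r + 1) : ℝ) = (m.succ : ℝ) / r.succ * m.choose r := by
      rw [div_mul_eq_mul_div, eq_div_iff (by positivity)]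
      exact_mod_cast (Nat.add_one_mul_choose_eq m r).symm
    rw [pow_succ', h2]
    exact mul_le_mul_of_nonneg_left h1 (by positivity)

theorem div_two_mul_pow_le_choose {a h : ℕ} (hh : 0 < h) (ha : 2 * h ≤ a) :
    ((a : ℝ) / (2 * h)) ^ h ≤ ((a - h).choose h : ℝ) := by
  refine (pow_le_pow_left₀ (by positivity) ?_ h).trans (div_pow_le_choose (by omega))
  have : (2 * h : ℝ) ≤ a := by exact_mod_cast ha
  have hh' : (0 : ℝ) < h := by exact_mod_cast hh
  rw [Nat.cast_sub (by omega), div_le_div_iff₀ (by positivity) hh']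
  nlinarith

theorem spectralNorm_nonneg (H : UHypergraph k n) (p : ℝ) : 0 ≤ spectralNorm H p := norm_nonneg _

/-- The spectral bound in polynomial form, free of roots and divisions. -/
theorem le_spectralBound_iff (hk2 : 2 ≤ k) (H : UHypergraph k n) {p : ℝ} (hp : p < 1) (L : ℕ) :
    (L : ℝ) ≤ spectralBound H p ↔ L < k ∨
      (L : ℝ) ^ k * (1 - p) ^ 2 ≤ (k : ℝ) ^ k * k.choose (k / 2) * spectralNorm H p ^ 2 := by
  have hk0 : (0 : ℝ) < k := by exact_mod_cast (by omega : 0 < k)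
  have hp1 : 1 - p ≠ 0 := by linarith
  have hp' : 0 < (1 - p) ^ 2 := by positivity
  have hN := spectralNorm_nonneg H p
  rw [spectralBound, le_max_iff]
  refine or_congr ?_ ?_
  · rw [le_sub_iff_add_le]
    exact_mod_cast Iff.rfl
  · rw [← div_le_iff₀' hk0, one_div (k : ℝ),
      Real.le_rpow_inv_iff_of_pos (by positivity) (by positivity) hk0, Real.rpow_natCast, div_pow,
      div_le_iff₀ (by positivity), ← mul_le_mul_iff_left₀ hp']
    generalize 1 - p = q at hp1 hp' ⊢
    rw [show 1 / q ^ 2 * (k.choose (k / 2) : ℝ) * spectralNorm H p ^ 2 * (k : ℝ) ^ k * q ^ 2 =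
      (k : ℝ) ^ k * k.choose (k / 2) * spectralNorm H p ^ 2 by field_simp]

theorem card_le_spectralBound (hk : Even k) (hk2 : 2 ≤ k) (H : UHypergraph k n) {p : ℝ}
    (hp : p < 1) {S : Finset (Fin n)} (hS : IsClique H S) :
    (S.card : ℝ) ≤ spectralBound H p := by
  rw [le_spectralBound_iff hk2 H hp]
  refine or_iff_not_imp_left.2 fun hlt => ?_
  have hkS : k ≤ S.card := not_lt.1 hlt
  obtain ⟨r, hr⟩ := hk
  have hkr : k = 2 * (k / 2) := by omega
  have hk0 : (0 : ℝ) < k := by exact_mod_cast (by omega : 0 < k)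
  have h1 := div_two_mul_pow_le_choose (a := S.card) (h := k / 2) (by omega) (by omega)
  have h2 := clique_le_spectralNorm ⟨r, hr⟩ H (p := p) hS hkS
  have hkc : (2 * ((k / 2 : ℕ) : ℝ)) = k := by exact_mod_cast hkr.symm
  rw [hkc] at h1
  have h3 : ((S.card : ℝ) / k) ^ k ≤ ((S.card - k / 2).choose (k / 2) : ℝ) ^ 2 := by
    rw [show (S.card / k : ℝ) ^ k = ((S.card / k : ℝ) ^ (k / 2)) ^ 2 by
      rw [← pow_mul, mul_comm (k / 2) 2, ← hkr]]
    exact pow_le_pow_left₀ (pow_nonneg (div_nonneg (Nat.cast_nonneg _) hk0.le) _) h1 2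
  have hc : (1 : ℝ) ≤ k.choose (k / 2) := by
    exact_mod_cast Nat.choose_pos (Nat.div_le_self k 2)
  rw [div_pow, div_le_iff₀ (by positivity)] at h3
  have hN : 0 ≤ spectralNorm H p ^ 2 := sq_nonneg _
  calc (S.card : ℝ) ^ k * (1 - p) ^ 2
      ≤ (((S.card - k / 2).choose (k / 2) : ℝ) ^ 2 * (k : ℝ) ^ k) * (1 - p) ^ 2 := by gcongr
    _ = (k : ℝ) ^ k * 1 * ((1 - p) * ((S.card - k / 2).choose (k / 2) : ℝ)) ^ 2 := by ring
    _ ≤ (k : ℝ) ^ k * k.choose (k / 2) * spectralNorm H p ^ 2 := by gcongr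

theorem cliqueNumber_le_spectralBound (hk : Even k) (hk2 : 2 ≤ k) (H : UHypergraph k n) {p : ℝ}
    (hp : p < 1) : (cliqueNumber H : ℝ) ≤ spectralBound H p := by
  classical
  have hne : (Finset.univ.filter fun S : Finset (Fin n) => IsClique H S).Nonempty := by
    refine ⟨∅, Finset.mem_filter.2 ⟨Finset.mem_univ _, fun C hC => ?_⟩⟩
    have h0 := Finset.card_le_card hC
    have := C.2
    simp only [Finset.card_empty] at h0
    omega
  obtain ⟨S, hS, h⟩ := Finset.exists_mem_eq_sup _ hne Finset.card
  have hcl : IsClique H S := (Finset.mem_filter.1 hS).2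
  have : cliqueNumber H = S.card := by unfold cliqueNumber; convert h
  rw [this]
  exact card_le_spectralBound hk hk2 H hp hcl

theorem cliqueNumber_le (H : UHypergraph k n) : cliqueNumber H ≤ n :=
  Finset.sup_le fun S _ => (Finset.card_le_univ S).trans_eq (Fintype.card_fin n)

theorem algOutput_le (H : UHypergraph k n) (p : ℝ) : algOutput H p ≤ n := by
  unfold algOutput
  split_ifs
  · exact le_rfl
  · exact min_le_left _ _

theorem cliqueNumber_le_algOutput (hk : Even k) (hk2 : 2 ≤ k) (H : UHypergraph k n)
    (p : unitInterval) : cliqueNumber H ≤ algOutput H (p : ℝ) := by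
  unfold algOutput
  split_ifs with h
  · exact cliqueNumber_le H
  · exact le_min (cliqueNumber_le H)
      (Nat.le_floor (cliqueNumber_le_spectralBound hk hk2 H (lt_of_le_of_ne p.2.2 h)))

end Completeness

/-! ### The trace moments of a symmetric matrix -/

section TraceMoments

variable {ι : Type*} [Fintype ι] [DecidableEq ι]

/-- The operator norm is at most the Frobenius norm. -/
theorem norm_toEuclideanCLM_sq_le (M : Matrix ι ι ℝ) :
    ‖Matrix.toEuclideanCLM (𝕜 := ℝ) M‖ ^ 2 ≤ ∑ i, ∑ l, M i l ^ 2 := by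
  rcases isEmpty_or_nonempty ι with h | h
  · have : Matrix.toEuclideanCLM (𝕜 := ℝ) M = 0 := Subsingleton.elim _ _
    simp [this]
  obtain ⟨x, hx, hle⟩ := exists_norm_sq_mul_le_sum_mulVec_sq M
  have hpos : 0 < ∑ i, x i ^ 2 := by
    obtain ⟨i, hi⟩ := Function.ne_iff.1 hx
    have : 0 < x i ^ 2 := by
      have : x i ≠ 0 := hi
      positivity
    exact this.trans_le (Finset.single_le_sum (f := fun i => x i ^ 2) (fun i _ => sq_nonneg _)
      (Finset.mem_univ i))
  refine le_of_mul_le_mul_right (hle.trans ?_) hpos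
  rw [Finset.sum_mul]
  exact Finset.sum_le_sum fun i _ => Finset.sum_mul_sq_le_sq_mul_sq _ _ _

theorem norm_pow_le_trace {A : Matrix ι ι ℝ} (hA : A.transpose = A) (j : ℕ) :
    ‖Matrix.toEuclideanCLM (𝕜 := ℝ) A‖ ^ 2 ^ (j + 1) ≤ (A ^ 2 ^ (j + 1)).trace := by
  have hsa : IsSelfAdjoint (Matrix.toEuclideanCLM (𝕜 := ℝ) A) := by
    refine IsSelfAdjoint.map ?_ _
    rw [← Matrix.isHermitian_iff_isSelfAdjoint]
    simpa [Matrix.IsHermitian] using hA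
  have hM : (A ^ 2 ^ j).transpose = A ^ 2 ^ j := by rw [Matrix.transpose_pow, hA]
  rw [pow_succ, pow_mul, ← hsa.norm_pow_two_pow, ← map_pow, pow_mul, sq (A ^ 2 ^ j)]
  refine (norm_toEuclideanCLM_sq_le _).trans_eq ?_
  simp only [Matrix.trace, Matrix.diag_apply, Matrix.mul_apply]
  refine Finset.sum_congr rfl fun i _ => Finset.sum_congr rfl fun l _ => ?_
  rw [sq, ← Matrix.transpose_apply (A ^ 2 ^ j) i l, hM]

/-- Entries of a power of a matrix as sums over walks, tested against `F`. -/
theorem sum_walks_mul (A : Matrix ι ι ℝ) (q : ℕ) (F : ι → ι → ℝ) :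
    ∑ w : Fin (q + 1) → ι, (∏ i : Fin q, A (w i.castSucc) (w i.succ)) * F (w 0) (w (Fin.last q)) =
      ∑ S, ∑ T, (A ^ q) S T * F S T := by
  induction q generalizing F with
  | zero =>
    rw [← (Equiv.funUnique (Fin 1) ι).symm.sum_comp]
    simp [Matrix.one_apply]
  | succ q ih =>
    have h1 : ∀ S : ι, ∀ w : Fin (q + 1) → ι,
        (∏ i : Fin (q + 1), A ((Fin.cons S w : Fin (q + 2) → ι) i.castSucc)
          ((Fin.cons S w : Fin (q + 2) → ι) i.succ)) *
          F ((Fin.cons S w : Fin (q + 2) → ι) 0)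
            ((Fin.cons S w : Fin (q + 2) → ι) (Fin.last (q + 1))) =
        (∏ i : Fin q, A (w i.castSucc) (w i.succ)) * (A S (w 0) * F S (w (Fin.last q))) := by
      intro S w
      rw [Fin.prod_univ_succ]
      simp only [Fin.castSucc_zero, Fin.cons_zero, Fin.cons_succ, Fin.castSucc_succ,
        ← Fin.succ_last]
      ring
    rw [← (Fin.consEquiv fun _ => ι).sum_comp, Fintype.sum_prod_type]
    refine Finset.sum_congr rfl fun S _ => ?_
    refine (Finset.sum_congr rfl fun w _ => h1 S w).trans ?_
    rw [ih fun U T => A S U * F S T]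
    rw [Finset.sum_comm]
    refine Finset.sum_congr rfl fun T _ => ?_
    rw [pow_succ', Matrix.mul_apply, Finset.sum_mul]
    refine Finset.sum_congr rfl fun U _ => ?_
    ring

/-- The trace of a power of a matrix is a sum over closed walks. -/
theorem trace_pow_eq_sum_walks (A : Matrix ι ι ℝ) (q : ℕ) :
    (A ^ q).trace = ∑ w : Fin (q + 1) → ι, (∏ i : Fin q, A (w i.castSucc) (w i.succ)) *
      if w 0 = w (Fin.last q) then 1 else 0 := by
  rw [sum_walks_mul A q fun S T => if S = T then 1 else 0]
  simp [Matrix.trace]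

end TraceMoments

/-! ### Expectations of products of edge weights -/

section Expectation

open MeasureTheory

variable {k n : ℕ}

/-- The expectation of a product of functions of the single edge weights factorizes. -/
theorem integral_prod_edgeWeight (p : unitInterval) (g : KSubset n k → ℝ → ℝ) :
    ∫ H, ∏ C, g C (edgeWeight H (p : ℝ) C) ∂randomHypergraph k n p =
      ∏ C, ((p : ℝ) * g C (1 - p) + (1 - p) * g C (-p)) := by
  classical
  have : IsProbabilityMeasure (randomHypergraph k n p) := by
    unfold randomHypergraph; infer_instance
  rw [integral_fintype .of_finite, Finset.prod_add, Finset.powerset_univ,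
    ← (Fintype.finsetEquivSet (α := KSubset n k)).sum_comp]
  refine Finset.sum_congr rfl fun s _ => ?_
  rw [Fintype.finsetEquivSet_apply, randomHypergraph,
    ProbabilityTheory.setBernoulli_real_singleton p (Set.subset_univ _) Set.finite_univ,
    Set.ncard_coe_finset, Finset.prod_mul_distrib, Finset.prod_mul_distrib, Finset.prod_const,
    Finset.prod_const, ← Finset.prod_mul_prod_compl s, smul_eq_mul,
    ← Finset.coe_univ, ← Finset.coe_sdiff, Set.ncard_coe_finset,
    ← Finset.compl_eq_univ_sdiff]
  have h1 : ∏ C ∈ s, g C (edgeWeight (s : Set (KSubset n k)) (p : ℝ) C) =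
      ∏ C ∈ s, g C (1 - p) :=
    Finset.prod_congr rfl fun C hC => by simp [edgeWeight, hC]
  have h2 : ∏ C ∈ sᶜ, g C (edgeWeight (s : Set (KSubset n k)) (p : ℝ) C) =
      ∏ C ∈ sᶜ, g C (-p) :=
    Finset.prod_congr rfl fun C hC => by simp [edgeWeight, Finset.mem_compl.1 hC]
  rw [h1, h2]
  ring

instance (p : unitInterval) : IsProbabilityMeasure (randomHypergraph k n p) := by
  unfold randomHypergraph; infer_instance

/-- A product of edge weights in which some edge occurs exactly once has mean zero. -/
theorem integral_prod_eq_zero (p : unitInterval) {q : ℕ} (C : Fin q → KSubset n k) (i : Fin q)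
    (hi : ∀ i', C i' = C i → i' = i) :
    ∫ H, ∏ i, edgeWeight H (p : ℝ) (C i) ∂randomHypergraph k n p = 0 := by
  classical
  set g : KSubset n k → ℝ → ℝ :=
    fun D y => y ^ (Finset.univ.filter fun i' => C i' = D).card with hg
  have h1 : ∀ H : UHypergraph k n, ∏ i, edgeWeight H (p : ℝ) (C i) =
      ∏ D, g D (edgeWeight H (p : ℝ) D) := by
    intro H
    rw [← Finset.prod_fiberwise_of_maps_to (s := Finset.univ) (t := Finset.univ) (g := C)
      fun _ _ => Finset.mem_univ _]
    refine Finset.prod_congr rfl fun D _ => ?_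
    simp only [hg]
    rw [← Finset.prod_const]
    exact Finset.prod_congr rfl fun i' hi' => by rw [(Finset.mem_filter.1 hi').2]
  rw [integral_congr_ae (.of_forall h1), integral_prod_edgeWeight p g]
  refine Finset.prod_eq_zero (Finset.mem_univ (C i)) ?_
  have : (Finset.univ.filter fun i' => C i' = C i) = {i} := by
    ext i'
    simp only [Finset.mem_filter, Finset.mem_univ, true_and, Finset.mem_singleton]
    exact ⟨hi i', fun h => by rw [h]⟩
  simp only [hg, this, Finset.card_singleton, pow_one]
  ring

theorem abs_integral_prod_le_one (p : unitInterval) {q : ℕ} (C : Fin q → KSubset n k) :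
    |∫ H, ∏ i, edgeWeight H (p : ℝ) (C i) ∂randomHypergraph k n p| ≤ 1 := by
  have := norm_integral_le_of_norm_le_const (μ := randomHypergraph k n p) (C := 1)
    (f := fun H => ∏ i, edgeWeight H (p : ℝ) (C i)) (.of_forall fun H => ?_)
  · simpa using this
  · rw [Real.norm_eq_abs, Finset.abs_prod]
    exact Finset.prod_le_one (fun _ _ => abs_nonneg _) fun _ _ => abs_edgeWeight_le_one H p _

end Expectation

/-! ### Counting walks in which every edge is repeated -/

section Counting

variable {k n : ℕ}

/-- Walks `w 0, …, w q` of `k/2`-sets whose steps are disjoint, and in which the union of the two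
ends of each step is also the union of the two ends of another step. -/
def IsRepetitive {q : ℕ} (w : Fin (q + 1) → KSubset n (k / 2)) : Prop :=
  (∀ i : Fin q, Disjoint (w i.castSucc).1 (w i.succ).1) ∧
    ∀ i : Fin q, ∃ i' : Fin q, i' ≠ i ∧
      (w i'.castSucc).1 ∪ (w i'.succ).1 = (w i.castSucc).1 ∪ (w i.succ).1

/-- The map to the first occurrence of the same value. Every value occurs twice, so at most half of
the indices are first occurrences. -/
theorem exists_firstOccurrence {q : ℕ} {α : Type*} [DecidableEq α] (C : Fin q → α)
    (hC : ∀ i, ∃ i', i' ≠ i ∧ C i' = C i) :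
    ∃ f : Fin q → Fin q, (∀ i, f i ≤ i) ∧ (∀ i, C (f i) = C i) ∧
      2 * (Finset.univ.filter fun i => f i = i).card ≤ q := by
  classical
  have hne : ∀ i, (Finset.univ.filter fun i' => C i' = C i).Nonempty := fun i =>
    ⟨i, by simp⟩
  set f : Fin q → Fin q := fun i => (Finset.univ.filter fun i' => C i' = C i).min' (hne i) with hf
  have hfC : ∀ i, C (f i) = C i := fun i => (Finset.mem_filter.1 (Finset.min'_mem _ (hne i))).2
  refine ⟨f, fun i => Finset.min'_le _ _ (by simp), hfC, ?_⟩
  have hinj : Set.InjOn C (Finset.univ.filter fun i => f i = i : Finset (Fin q)) := by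
    intro i hi i' hi' h
    have h1 : f i = i := by simpa using hi
    have h2 : f i' = i' := by simpa using hi'
    rw [← h1, ← h2]
    simp only [hf, h]
  rw [← Finset.card_image_of_injOn hinj]
  calc 2 * ((Finset.univ.filter fun i => f i = i).image C).card
      ≤ 2 * (Finset.univ.image C).card := by gcongr; exact Finset.filter_subset _ _
    _ ≤ (Finset.univ : Finset (Fin q)).card := by
        refine Finset.mul_card_image_le_card _ 2 fun a ha => ?_
        obtain ⟨i, -, rfl⟩ := Finset.mem_image.1 ha
        obtain ⟨i', hne', hi'⟩ := hC i
        exact Finset.one_lt_card.2 ⟨i', by simp [hi'], i, by simp, hne'⟩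
    _ = q := by simp

/-- A walk whose repetitions are prescribed by `f` is determined by its start and by the end points
of the steps that are first occurrences. -/
theorem card_walks_le {q : ℕ} (f : Fin q → Fin q) (hf : ∀ i, f i ≤ i)
    (W : Finset (Fin (q + 1) → KSubset n (k / 2)))
    (hd : ∀ w ∈ W, ∀ i : Fin q, Disjoint (w i.castSucc).1 (w i.succ).1)
    (hW : ∀ w ∈ W, ∀ i : Fin q,
      (w (f i).castSucc).1 ∪ (w (f i).succ).1 = (w i.castSucc).1 ∪ (w i.succ).1) :
    W.card ≤ Fintype.card (KSubset n (k / 2)) *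
      Fintype.card (KSubset n (k / 2)) ^ (Finset.univ.filter fun i => f i = i).card := by
  classical
  have hcard : Fintype.card (KSubset n (k / 2) × ({i // f i = i} → KSubset n (k / 2))) =
      Fintype.card (KSubset n (k / 2)) *
      Fintype.card (KSubset n (k / 2)) ^ (Finset.univ.filter fun i => f i = i).card := by
    rw [Fintype.card_prod, Fintype.card_fun, Fintype.card_subtype (fun i => f i = i)]
  rw [← hcard, ← Finset.card_univ]
  refine Finset.card_le_card_of_injOn (fun w => (w 0, fun i => w i.1.succ))
    (fun _ _ => Finset.mem_univ _) ?_
  intro w hw w' hw' h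
  have h0 : w 0 = w' 0 := congrArg Prod.fst h
  have h1 : ∀ i, f i = i → w i.succ = w' i.succ := fun i hi =>
    congrFun (congrArg Prod.snd h) ⟨i, hi⟩
  -- `w (i+1)` is the complement of `w i` in an edge that is either new or known already
  have key : ∀ m : ℕ, ∀ hm : m < q + 1, w ⟨m, hm⟩ = w' ⟨m, hm⟩ := by
    intro m
    induction m using Nat.strong_induction_on with
    | _ m ih =>
      intro hm
      rcases Nat.eq_zero_or_pos m with rfl | hpos
      · exact h0
      set i : Fin q := ⟨m - 1, by omega⟩ with hi
      have hsucc : (⟨m, hm⟩ : Fin (q + 1)) = i.succ := by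
        ext; simp [hi]; omega
      rw [hsucc]
      by_cases hfi : f i = i
      · exact h1 i hfi
      have hlt : (f i : ℕ) < m - 1 := lt_of_le_of_ne (hf i) fun h => hfi (Fin.ext h)
      have e1 : w i.castSucc = w' i.castSucc := ih (m - 1) (by omega) (by omega)
      have e2 : w (f i).castSucc = w' (f i).castSucc := ih (f i) (by omega) (by omega)
      have e3 : w (f i).succ = w' (f i).succ := ih (f i + 1) (by omega) (by omega)
      have e4 := hW w hw i
      have e5 := hW w' hw' i
      rw [e2, e3, e1, e5] at e4
      have d1 := hd w hw i
      have d2 := hd w' hw' i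
      rw [e1] at d1
      apply Subtype.ext
      rw [← Finset.union_sdiff_cancel_left d1, ← e4, Finset.union_sdiff_cancel_left d2]
  funext m
  exact key m.1 m.2

open Classical in
theorem card_repetitive_le {D : ℕ} (hD : 0 < D)
    (hdD : Fintype.card (KSubset n (k / 2)) ≤ D) (q : ℕ) :
    (Finset.univ.filter fun w : Fin (q + 1) → KSubset n (k / 2) => IsRepetitive w).card ≤
      q ^ q * (D * D ^ (q / 2)) := by
  set good : (Fin q → Fin q) → Finset (Fin (q + 1) → KSubset n (k / 2)) := fun f =>
    Finset.univ.filter fun w => (∀ i : Fin q, Disjoint (w i.castSucc).1 (w i.succ).1) ∧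
      ∀ i : Fin q, (w (f i).castSucc).1 ∪ (w (f i).succ).1 = (w i.castSucc).1 ∪ (w i.succ).1
    with hgood
  set Fs : Finset (Fin q → Fin q) := Finset.univ.filter fun f => (∀ i, f i ≤ i) ∧
    2 * (Finset.univ.filter fun i => f i = i).card ≤ q with hFs
  have hsub : (Finset.univ.filter fun w : Fin (q + 1) → KSubset n (k / 2) => IsRepetitive w) ⊆
      Fs.biUnion good := by
    intro w hw
    obtain ⟨h1, h2⟩ := (Finset.mem_filter.1 hw).2
    obtain ⟨f, hf1, hf2, hf3⟩ :=
      exists_firstOccurrence (fun i : Fin q => (w i.castSucc).1 ∪ (w i.succ).1) h2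
    exact Finset.mem_biUnion.2 ⟨f, by simp [hFs, hf1, hf3], by simp [hgood, h1]; exact hf2⟩
  refine (Finset.card_le_card hsub).trans
    ((Finset.card_biUnion_le_card_mul _ _ (D * D ^ (q / 2)) ?_).trans ?_)
  · intro f hf
    obtain ⟨h1, h2⟩ := (Finset.mem_filter.1 hf).2
    refine (card_walks_le f h1 (good f) (fun w hw => (Finset.mem_filter.1 hw).2.1)
      fun w hw => (Finset.mem_filter.1 hw).2.2).trans ?_
    exact Nat.mul_le_mul hdD
      ((Nat.pow_le_pow_left hdD _).trans (Nat.pow_le_pow_right hD (by omega)))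
  · refine Nat.mul_le_mul_right _ ((Finset.card_le_univ _).trans_eq ?_)
    simp

end Counting

/-! ### Concentration of the spectral norm -/

section Concentration

open MeasureTheory

variable {k n : ℕ}

/-- Only repetitive walks contribute to the expected trace, and each of them at most `1`. -/
theorem integral_prod_spectralMatrix_le (hk : Even k) (p : unitInterval) {q : ℕ}
    (w : Fin (q + 1) → KSubset n (k / 2)) [Decidable (IsRepetitive w)] :
    ∫ H, ∏ i : Fin q, spectralMatrix H (p : ℝ) (w i.castSucc) (w i.succ) ∂randomHypergraph k n p ≤
      if IsRepetitive w then 1 else 0 := by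
  by_cases hd : ∀ i : Fin q, Disjoint (w i.castSucc).1 (w i.succ).1
  · set C : Fin q → KSubset n k := fun i =>
      ⟨(w i.castSucc).1 ∪ (w i.succ).1, card_union_of_disjoint hk (hd i)⟩ with hC
    have h1 : ∀ H : UHypergraph k n,
        ∏ i : Fin q, spectralMatrix H (p : ℝ) (w i.castSucc) (w i.succ) =
          ∏ i, edgeWeight H (p : ℝ) (C i) := fun H =>
      Finset.prod_congr rfl fun i _ => spectralMatrix_apply_of_union_eq H _ rfl
    rw [integral_congr_ae (.of_forall h1)]
    by_cases hr : ∀ i : Fin q, ∃ i' : Fin q, i' ≠ i ∧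
      (w i'.castSucc).1 ∪ (w i'.succ).1 = (w i.castSucc).1 ∪ (w i.succ).1
    · rw [if_pos ⟨hd, hr⟩]
      exact (le_abs_self _).trans (abs_integral_prod_le_one p C)
    · rw [if_neg fun h => hr h.2]
      push Not at hr
      obtain ⟨i, hi⟩ := hr
      refine (integral_prod_eq_zero p C i fun i' h => ?_).le
      by_contra hne
      exact hi i' hne (congrArg Subtype.val h)
  · rw [if_neg fun h => hd h.1]
    push Not at hd
    obtain ⟨i, hi⟩ := hd
    have h1 : ∀ H : UHypergraph k n,
        ∏ i : Fin q, spectralMatrix H (p : ℝ) (w i.castSucc) (w i.succ) = 0 := fun H =>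
      Finset.prod_eq_zero (Finset.mem_univ i) (spectralMatrix_apply_of_not_disjoint hk H _ hi)
    rw [integral_congr_ae (.of_forall h1)]
    simp

theorem integral_spectralNorm_pow_le (hk : Even k) (p : unitInterval) {D : ℕ} (hD : 0 < D)
    (hdD : Fintype.card (KSubset n (k / 2)) ≤ D) (j : ℕ) :
    ∫ H, spectralNorm H (p : ℝ) ^ 2 ^ (j + 1) ∂randomHypergraph k n p ≤
      ((2 ^ (j + 1) : ℕ) : ℝ) ^ 2 ^ (j + 1) * (D * (D : ℝ) ^ 2 ^ j) := by
  classical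
  have hq : 2 ^ (j + 1) / 2 = 2 ^ j := by rw [pow_succ]; simp
  calc ∫ H, spectralNorm H (p : ℝ) ^ 2 ^ (j + 1) ∂randomHypergraph k n p
      ≤ ∫ H, (spectralMatrix H (p : ℝ) ^ 2 ^ (j + 1)).trace ∂randomHypergraph k n p :=
        integral_mono .of_finite .of_finite fun H =>
          norm_pow_le_trace (spectralMatrix_transpose H _) j
    _ ≤ ∑ w : Fin (2 ^ (j + 1) + 1) → KSubset n (k / 2), if IsRepetitive w then (1 : ℝ) else 0 := by
        simp only [trace_pow_eq_sum_walks]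
        rw [integral_finsetSum _ fun _ _ => .of_finite]
        refine Finset.sum_le_sum fun w _ => ?_
        rw [integral_mul_const]
        split_ifs with h1 h2 h2
        · simpa [h2] using integral_prod_spectralMatrix_le hk p w
        · simpa [h2] using integral_prod_spectralMatrix_le hk p w
        · simp
        · simp
    _ ≤ _ := by
        rw [Finset.sum_boole]
        have := card_repetitive_le (k := k) hD hdD (2 ^ (j + 1))
        rw [hq] at this
        exact_mod_cast this

theorem card_KSubset_le (n m : ℕ) : Fintype.card (KSubset n m) ≤ n ^ m := by
  rw [Fintype.card_finset_len, Fintype.card_fin]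
  exact Nat.choose_le_pow n m

/-- Markov's inequality for a moment whose order is a power of two slightly larger than
`(k / 2 + c) * log n`. -/
theorem measure_spectralNorm_gt_le (hk : Even k) (hk2 : 2 ≤ k) (hn : 2 ≤ n) (p : unitInterval)
    {c : ℝ} (hc : 1 ≤ c) :
    (randomHypergraph k n p).real
      {H | 48 * (k * c * Real.log n) ^ 2 * (n : ℝ) ^ (k / 2) < spectralNorm H (p : ℝ) ^ 2} ≤
      (n : ℝ) ^ (-c) := by
  set h := k / 2 with hh
  have hkh : (k : ℝ) = 2 * h := by
    obtain ⟨r, hr⟩ := hk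
    exact_mod_cast (by omega : k = 2 * h)
  have hh1 : (1 : ℝ) ≤ h := by exact_mod_cast (by omega : 1 ≤ h)
  have hn0 : (0 : ℝ) < n := by exact_mod_cast (by omega : 0 < n)
  have hlog : 1 / 2 < Real.log n := by
    have h1 : Real.log 2 ≤ Real.log n := Real.log_le_log (by norm_num) (by exact_mod_cast hn)
    have := Real.log_two_gt_d9
    linarith
  set M : ℝ := (h + c) * Real.log n with hM
  have hM1 : 1 ≤ M := by nlinarith
  -- `q = 2 ^ (j + 1)` with `M < 2 ^ j ≤ 2 * M`
  obtain ⟨i, hi1, hi2⟩ := exists_nat_pow_near hM1 one_lt_two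
  set j := i + 1 with hj
  have hjM : (2 : ℝ) ^ j ≤ 2 * M := by rw [hj, pow_succ]; linarith
  set D : ℕ := n ^ h with hD
  have hD0 : 0 < D := by positivity
  have hD0' : (0 : ℝ) < D := by exact_mod_cast hD0
  -- `48 = 16 * 3`: the moment bound costs `16`, and `3 > exp 1` yields the decay `exp (-M)`
  set Q : ℝ := 48 * (k * c * Real.log n) ^ 2 * (n : ℝ) ^ h with hQ
  have hkc : 0 < k * c * Real.log n := by rw [hkh]; positivity
  have hQ0 : 0 < Q := by positivity
  -- `h + c ≤ 2 * h * c` because `h` and `c` are at least `1`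
  have hMk : M ≤ k * c * Real.log n := by
    rw [hM, hkh]
    refine mul_le_mul_of_nonneg_right ?_ (by linarith)
    nlinarith
  have hmom := integral_spectralNorm_pow_le hk p hD0 (card_KSubset_le n h) j
  have hmark := mul_meas_ge_le_integral_of_nonneg (μ := randomHypergraph k n p)
    (f := fun H => spectralNorm H (p : ℝ) ^ 2 ^ (j + 1))
    (.of_forall fun H => pow_nonneg (spectralNorm_nonneg H _) _) .of_finite (Q ^ 2 ^ j)
  have hsub : (randomHypergraph k n p).real {H | Q < spectralNorm H (p : ℝ) ^ 2} ≤
      (randomHypergraph k n p).real {H | Q ^ 2 ^ j ≤ spectralNorm H (p : ℝ) ^ 2 ^ (j + 1)} := by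
    refine measureReal_mono fun H hH => ?_
    have hH' : Q < spectralNorm H (p : ℝ) ^ 2 := hH
    show Q ^ 2 ^ j ≤ spectralNorm H (p : ℝ) ^ 2 ^ (j + 1)
    rw [pow_succ 2 j, mul_comm, pow_mul]
    exact pow_le_pow_left₀ hQ0.le hH'.le _
  have hq : (((2 ^ (j + 1) : ℕ) : ℝ) ^ 2 * D) ≤ Q / 3 := by
    have e1 : ((2 ^ (j + 1) : ℕ) : ℝ) ≤ 4 * (k * c * Real.log n) := by
      push_cast
      rw [pow_succ]
      linarith
    have e2 := pow_le_pow_left₀ (by positivity) e1 2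
    have e3 : (D : ℝ) = (n : ℝ) ^ h := by rw [hD]; push_cast; rfl
    rw [hQ, ← e3]
    nlinarith
  have hchain : Q ^ 2 ^ j * (randomHypergraph k n p).real {H | Q < spectralNorm H (p : ℝ) ^ 2} ≤
      Q ^ 2 ^ j * (D / 3 ^ 2 ^ j) := by
    calc _ ≤ _ := mul_le_mul_of_nonneg_left hsub (by positivity)
      _ ≤ _ := hmark.trans hmom
      _ = (((2 ^ (j + 1) : ℕ) : ℝ) ^ 2 * D) ^ 2 ^ j * D := by
          rw [pow_succ 2 j, mul_comm (2 ^ j) 2, pow_mul, mul_pow]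
          ring
      _ ≤ (Q / 3) ^ 2 ^ j * D := by gcongr
      _ = _ := by rw [div_pow]; ring
  refine (le_of_mul_le_mul_left hchain (by positivity)).trans ?_
  have hexp : Real.exp M ≤ 3 ^ 2 ^ j := by
    calc Real.exp M ≤ Real.exp ((2 ^ j : ℕ) : ℝ) := by
          apply Real.exp_le_exp.2; push_cast; exact hi2.le
      _ = Real.exp 1 ^ 2 ^ j := by rw [← Real.exp_nat_mul, mul_one]
      _ ≤ 3 ^ 2 ^ j := by
          have := Real.exp_one_lt_d9
          gcongr
          linarith
  have hDe : (D : ℝ) = Real.exp (Real.log n * h) := by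
    rw [hD, ← Real.rpow_def_of_pos hn0]; simp
  rw [Real.rpow_def_of_pos hn0]
  calc (D : ℝ) / 3 ^ 2 ^ j ≤ D / Real.exp M := by gcongr
    _ = _ := by rw [hDe, ← Real.exp_sub, hM]; ring_nf

theorem spectralBound_le_of_spectralNorm_sq_le (hk : Even k) (hk2 : 2 ≤ k) (hn : 2 ≤ n) (H : UHypergraph k n)
    (p : unitInterval) (hp : (p : ℝ) < 1) {c : ℝ} (hc : 1 ≤ c)
    (hH : spectralNorm H (p : ℝ) ^ 2 ≤ 48 * (k * c * Real.log n) ^ 2 * (n : ℝ) ^ (k / 2)) :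
    spectralBound H (p : ℝ) ≤
      56 * k * (c * Real.log n / (1 - p)) ^ (2 / (k : ℝ)) * √(n : ℝ) := by
  have hk0 : (2 : ℝ) ≤ k := by exact_mod_cast hk2
  have hn1 : (1 : ℝ) ≤ n := by exact_mod_cast (by omega : 1 ≤ n)
  have hlog : 1 / 2 < Real.log n := by
    have h1 : Real.log 2 ≤ Real.log n := Real.log_le_log (by norm_num) (by exact_mod_cast hn)
    have := Real.log_two_gt_d9
    linarith
  have hr0 : (0 : ℝ) < 1 - p := by linarith
  have hr1 : (1 : ℝ) - p ≤ 1 := by linarith [p.2.1]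
  unfold spectralBound
  generalize (1 : ℝ) - p = r at hr0 hr1 ⊢
  have hN : 0 ≤ spectralNorm H (p : ℝ) ^ 2 := sq_nonneg _
  generalize spectralNorm H (p : ℝ) ^ 2 = N at hH hN ⊢
  rw [mul_assoc _ c] at hH
  have hX : 1 / 2 ≤ c * Real.log n := by nlinarith
  generalize c * Real.log n = X at hX hH ⊢
  refine max_le ?_ ?_
  · have h1 : (1 / 2 : ℝ) ≤ (X / r) ^ (2 / (k : ℝ)) := by
      calc (1 / 2 : ℝ) = (1 / 2 : ℝ) ^ (1 : ℝ) := by rw [Real.rpow_one]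
        _ ≤ (1 / 2 : ℝ) ^ (2 / (k : ℝ)) :=
          Real.rpow_le_rpow_of_exponent_ge (by norm_num) (by norm_num)
            ((div_le_one (by linarith)).2 hk0)
        _ ≤ _ := by
          refine Real.rpow_le_rpow (by norm_num) ?_ (by positivity)
          rw [le_div_iff₀ hr0]
          nlinarith
    have h2 : 1 ≤ √(n : ℝ) := Real.one_le_sqrt.2 hn1
    calc (k : ℝ) - 1 ≤ 56 * k * (1 / 2) * 1 := by linarith
      _ ≤ _ := by gcongr
  · have hk2' : k = 2 * (k / 2) := by
      obtain ⟨s, hs⟩ := hk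
      omega
    have hX0 : 0 ≤ X := by linarith
    have hpow : (56 * (X / r) ^ (2 / (k : ℝ)) * √(n : ℝ)) ^ k =
        56 ^ k * (X / r) ^ 2 * (n : ℝ) ^ (k / 2) := by
      rw [mul_pow, mul_pow, ← Real.rpow_natCast ((X / r) ^ (2 / (k : ℝ))), ← Real.rpow_mul
        (by positivity), div_mul_cancel₀ _ (by positivity : (k : ℝ) ≠ 0), Real.rpow_two]
      congr 1
      conv_lhs => rw [hk2', pow_mul, Real.sq_sqrt (by linarith)]
    -- `56 = 2 * 7 * 4`
    have hconst : (k.choose (k / 2) : ℝ) * 48 * k ^ 2 ≤ 56 ^ k := by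
      have h1 : (k.choose (k / 2) : ℝ) ≤ 2 ^ k := by exact_mod_cast Nat.choose_le_two_pow k _
      have h2 : (48 : ℝ) ≤ 7 ^ k := le_trans (by norm_num)
        (pow_le_pow_right₀ (by norm_num : (1 : ℝ) ≤ 7) hk2)
      have h3 : (k : ℝ) ^ 2 ≤ 4 ^ k := by
        have : (k : ℝ) ≤ 2 ^ k := by exact_mod_cast Nat.lt_two_pow_self.le
        calc (k : ℝ) ^ 2 ≤ (2 ^ k) ^ 2 := by gcongr
          _ = 4 ^ k := by rw [← pow_mul, mul_comm, pow_mul]; norm_num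
      calc (k.choose (k / 2) : ℝ) * 48 * k ^ 2 ≤ 2 ^ k * 7 ^ k * 4 ^ k := by gcongr
        _ = 56 ^ k := by rw [← mul_pow, ← mul_pow]; norm_num
    have hle : (1 / r ^ 2 * (k.choose (k / 2) : ℝ) * N) ^ (1 / (k : ℝ)) ≤
        56 * (X / r) ^ (2 / (k : ℝ)) * √(n : ℝ) := by
      rw [one_div (k : ℝ), Real.rpow_inv_le_iff_of_pos (by positivity) (by positivity)
        (by positivity), Real.rpow_natCast, hpow]
      calc 1 / r ^ 2 * (k.choose (k / 2) : ℝ) * N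
          ≤ 1 / r ^ 2 * (k.choose (k / 2) : ℝ) * (48 * (k * X) ^ 2 * (n : ℝ) ^ (k / 2)) := by
            gcongr
        _ = (k.choose (k / 2) * 48 * k ^ 2) * (X / r) ^ 2 * (n : ℝ) ^ (k / 2) := by
            rw [div_pow]; ring
        _ ≤ 56 ^ k * (X / r) ^ 2 * (n : ℝ) ^ (k / 2) := by gcongr
    calc (k : ℝ) * (1 / r ^ 2 * (k.choose (k / 2) : ℝ) * N) ^ (1 / (k : ℝ))
        ≤ k * (56 * (X / r) ^ (2 / (k : ℝ)) * √(n : ℝ)) := by gcongr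
      _ = _ := by ring

theorem high_probability_bound (hk : Even k) (hk2 : 2 ≤ k) (hn : 1 ≤ n)
    (p : unitInterval) (hp : (p : ℝ) < 1) {c : ℝ} (hc : 1 ≤ c) :
    1 - (n : ℝ) ^ (-c) ≤ (randomHypergraph k n p).real
      {H | (algOutput H (p : ℝ) : ℝ) ≤
            56 * k * (c * Real.log n / (1 - p)) ^ (2 / (k : ℝ)) * √(n : ℝ) ∧
          spectralBound H (p : ℝ) ≤
            56 * k * (c * Real.log n / (1 - p)) ^ (2 / (k : ℝ)) * √(n : ℝ)} := by
  -- for `n = 1` the probability bound `1 - n ^ (-c)` is `0`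
  rcases hn.eq_or_lt with rfl | hn
  · simp
  have hbad := measure_spectralNorm_gt_le hk hk2 hn p hc
  set bad := {H : UHypergraph k n |
    48 * (k * c * Real.log n) ^ 2 * (n : ℝ) ^ (k / 2) < spectralNorm H (p : ℝ) ^ 2} with hbaddef
  have hcompl := probReal_compl_eq_one_sub (μ := randomHypergraph k n p)
    (show MeasurableSet bad from bad.toFinite.measurableSet)
  refine (by linarith : 1 - (n : ℝ) ^ (-c) ≤ (randomHypergraph k n p).real badᶜ).trans
    (measureReal_mono fun H hH => ?_)
  have hH' : spectralNorm H (p : ℝ) ^ 2 ≤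
      48 * (k * c * Real.log n) ^ 2 * (n : ℝ) ^ (k / 2) := not_lt.1 hH
  have hb := spectralBound_le_of_spectralNorm_sq_le hk hk2 hn H p hp hc hH'
  refine ⟨le_trans ?_ hb, hb⟩
  rw [algOutput, if_neg hp.ne]
  have h0 : 0 ≤ spectralBound H (p : ℝ) := by
    refine le_trans ?_ (le_max_left _ _)
    have : (2 : ℝ) ≤ k := by exact_mod_cast hk2
    linarith
  exact le_trans (by exact_mod_cast min_le_right _ _) (Nat.floor_le h0)

end Concentration

/-! ### Reasoning about programs -/

/-- A variable or a whole array of the machine. -/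
inductive Loc where
  | nat (x : ℕ)
  | natArr (a : ℕ)
  | real (r : ℕ)
  | realArr (a : ℕ)

/-- The two locations are different. -/
def Loc.differs : Loc → Loc → Bool
  | .nat x, .nat y => decide (x ≠ y)
  | .natArr x, .natArr y => decide (x ≠ y)
  | .real x, .real y => decide (x ≠ y)
  | .realArr x, .realArr y => decide (x ≠ y)
  | _, _ => true

/-- The location that an instruction writes to. -/
def Instr.target : Instr → Loc
  | .natConst x _ => .nat x
  | .natAdd x _ _ => .nat x
  | .natSub x _ _ => .nat x
  | .natLoad x _ _ => .nat x
  | .natStore a _ _ => .natArr a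
  | .realOfNat r _ => .real r
  | .realAdd r _ _ => .real r
  | .realSub r _ _ => .real r
  | .realMul r _ _ => .real r
  | .realDiv r _ _ => .real r
  | .realLoad r _ _ => .real r
  | .realStore a _ _ => .realArr a

/-- No instruction of the program writes to the given location. -/
def Program.avoids : Program → Loc → Bool
  | .instr i, l => i.target.differs l
  | .seq P Q, l => P.avoids l && Q.avoids l
  | .ite _ P Q, l => P.avoids l && Q.avoids l
  | .while _ P, l => P.avoids l

/-- Two memories have the same content at a location. -/
def State.Same (m m' : State) : Loc → Prop
  | .nat x => m'.nat x = m.nat x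
  | .natArr a => m'.natArr a = m.natArr a
  | .real r => m'.real r = m.real r
  | .realArr a => m'.realArr a = m.realArr a

theorem State.Same.refl (m : State) (l : Loc) : m.Same m l := by
  cases l <;> rfl

theorem State.Same.trans {m m' m'' : State} {l : Loc} (h : m.Same m' l) (h' : m'.Same m'' l) :
    m.Same m'' l := by
  cases l <;> exact Eq.trans h' h

theorem Instr.same_of_exec {i : Instr} {m m' : State} (h : i.exec m = some m') {l : Loc}
    (hl : i.target.differs l = true) : m.Same m' l := by
  cases i <;> simp only [Instr.exec, Option.some.injEq, Option.ite_none_left_eq_some] at h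
  case realDiv =>
    obtain ⟨-, rfl⟩ := h
    cases l <;> first | rfl | exact Function.update_of_ne (Ne.symm (of_decide_eq_true hl)) _ _
  all_goals
    subst h
    cases l <;> first | rfl | exact Function.update_of_ne (Ne.symm (of_decide_eq_true hl)) _ _

/-- The final memory agrees with the initial one outside the locations that `P` writes to. -/
def Frame (P : Program) (m m' : State) : Prop := ∀ l, P.avoids l = true → m.Same m' l

theorem Runs.frame {P : Program} {m m' : State} {t : ℕ} (h : Runs P m t m') : Frame P m m' := by
  induction h with
  | instr h => exact fun l hl => Instr.same_of_exec h hl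
  | seq _ _ ih1 ih2 =>
    intro l hl
    rw [Program.avoids, Bool.and_eq_true] at hl
    exact (ih1 l hl.1).trans (ih2 l hl.2)
  | iteTrue _ _ ih =>
    intro l hl
    rw [Program.avoids, Bool.and_eq_true] at hl
    exact ih l hl.1
  | iteFalse _ _ ih =>
    intro l hl
    rw [Program.avoids, Bool.and_eq_true] at hl
    exact ih l hl.2
  | whileTrue _ _ _ ih1 ih2 => exact fun l hl => (ih1 l hl).trans (ih2 l hl)
  | whileFalse _ => exact fun l _ => State.Same.refl _ l

namespace Frame

variable {P Q : Program} {m m' m'' : State}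

theorem trans (h : Frame P m m') (h' : Frame P m' m'') : Frame P m m'' :=
  fun l hl => (h l hl).trans (h' l hl)

theorem mono (h : Frame Q m m') (hPQ : ∀ l, P.avoids l = true → Q.avoids l = true) :
    Frame P m m' := fun l hl => h l (hPQ l hl)

theorem nat (h : Frame P m m') (x : ℕ) (hx : P.avoids (.nat x) = true := by rfl) :
    m'.nat x = m.nat x := h (.nat x) hx

theorem natArr (h : Frame P m m') (a : ℕ) (ha : P.avoids (.natArr a) = true := by rfl) :
    m'.natArr a = m.natArr a := h (.natArr a) ha

theorem real (h : Frame P m m') (r : ℕ) (hr : P.avoids (.real r) = true := by rfl) :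
    m'.real r = m.real r := h (.real r) hr

theorem realArr (h : Frame P m m') (a : ℕ) (ha : P.avoids (.realArr a) = true := by rfl) :
    m'.realArr a = m.realArr a := h (.realArr a) ha

end Frame

/-- Total correctness with a time bound: started in `m`, the program halts after at most `T` steps
in a memory that satisfies `R`. -/
def Achieves (P : Program) (m : State) (T : ℕ) (R : State → Prop) : Prop :=
  ∃ t m', Runs P m t m' ∧ t ≤ T ∧ R m'

namespace Achieves

variable {P Q : Program} {m : State} {T U : ℕ} {R R' : State → Prop} {b : Test}

theorem weaken (h : Achieves P m T R) (hTU : T ≤ U) (hR : ∀ m', Frame P m m' → R m' → R' m') :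
    Achieves P m U R' := by
  obtain ⟨t, m', hr, ht, hm⟩ := h
  exact ⟨t, m', hr, ht.trans hTU, hR m' hr.frame hm⟩

theorem seq (h : Achieves P m T R) (h' : ∀ m', Frame P m m' → R m' → Achieves Q m' U R') :
    Achieves (.seq P Q) m (T + U) R' := by
  obtain ⟨t, m', hr, ht, hm⟩ := h
  obtain ⟨u, m'', hr', hu, hm'⟩ := h' m' hr.frame hm
  exact ⟨t + u, m'', .seq hr hr', Nat.add_le_add ht hu, hm'⟩

theorem ite (h : b.Holds m → Achieves P m T R) (h' : ¬ b.Holds m → Achieves Q m T R) :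
    Achieves (.ite b P Q) m (T + 1) R := by
  by_cases hb : b.Holds m
  · obtain ⟨t, m', hr, ht, hm⟩ := h hb
    exact ⟨t + 1, m', .iteTrue hb hr, by omega, hm⟩
  · obtain ⟨t, m', hr, ht, hm⟩ := h' hb
    exact ⟨t + 1, m', .iteFalse hb hr, by omega, hm⟩

end Achieves

/-- Memory with the natural variable `x` set to `v`. -/
def State.setNat (m : State) (x v : ℕ) : State := { m with nat := Function.update m.nat x v }

@[simp] theorem State.setNat_nat (m : State) (x v y : ℕ) :
    (m.setNat x v).nat y = if y = x then v else m.nat y := Function.update_apply ..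

@[simp] theorem State.setNat_natArr (m : State) (x v : ℕ) : (m.setNat x v).natArr = m.natArr := rfl

@[simp] theorem State.setNat_real (m : State) (x v : ℕ) : (m.setNat x v).real = m.real := rfl

@[simp] theorem State.setNat_realArr (m : State) (x v : ℕ) :
    (m.setNat x v).realArr = m.realArr := rfl

/-- The program that does nothing; the natural variable `98` is never read. -/
def skip : Program := .instr (.natConst 98 0)

/-- A sequence of instructions. -/
def block : List Instr → Program
  | [] => skip
  | [i] => .instr i
  | i :: j :: l => .seq (.instr i) (block (j :: l))

/-- Effect of a nonempty sequence of instructions. -/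
noncomputable def execList : List Instr → State → Option State
  | [], m => some m
  | i :: l, m => (i.exec m).bind (execList l)

theorem Achieves.block {l : List Instr} {m m' : State} {R : State → Prop} (hl : l ≠ [])
    (h : execList l m = some m') (hR : R m') : Achieves (block l) m l.length R := by
  induction l generalizing m with
  | nil => exact absurd rfl hl
  | cons i l ih =>
    rw [execList, Option.bind_eq_some_iff] at h
    obtain ⟨m₁, h1, h2⟩ := h
    cases l with
    | nil =>
      rw [execList, Option.some.injEq] at h2
      subst h2
      exact ⟨1, _, .instr h1, le_rfl, hR⟩
    | cons j l =>
      obtain ⟨t, m'', hr, ht, hm⟩ := ih (by simp) h2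
      exact ⟨1 + t, m'', .seq (.instr h1) hr, by simp only [List.length_cons] at ht ⊢; omega, hm⟩

theorem Achieves.skip {m : State} {R : State → Prop} (h : R (m.setNat 98 0)) :
    Achieves skip m 1 R :=
  ⟨1, _, .instr rfl, le_rfl, h⟩

/-- `for x := 0, …, N - 1 do body`, where `N` is the value of the natural variable with that name
and the natural variable `2` is kept at `1` throughout. -/
def forLoop (x N : ℕ) (body : Program) : Program :=
  .seq (.instr (.natConst x 0))
    (.while (.natLt x N) (.seq body (.instr (.natAdd x x 2))))

theorem forLoop_avoids (x N : ℕ) (body : Program) (l : Loc) :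
    (forLoop x N body).avoids l = true ↔ (Loc.nat x).differs l = true ∧ body.avoids l = true := by
  simp only [forLoop, Program.avoids, Instr.target, Bool.and_eq_true]
  tauto

theorem Loc.nat_differs_nat {x y : ℕ} (h : x ≠ y) : (Loc.nat x).differs (.nat y) = true := by
  simp [Loc.differs, h]

/-- The rule for loops with an invariant, which at index `i` holds before the `i`-th round. -/
theorem Achieves.forLoop {x N : ℕ} {body : Program} {m : State} {T : ℕ} (Inv : ℕ → State → Prop)
    (hbx : body.avoids (.nat x) = true) (hbN : body.avoids (.nat N) = true)
    (hb2 : body.avoids (.nat 2) = true) (hxN : x ≠ N) (hx2 : x ≠ 2) (h2 : m.nat 2 = 1)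
    (h0 : Inv 0 (m.setNat x 0))
    (step : ∀ i m', i < m.nat N → Frame (forLoop x N body) m m' → m'.nat x = i → Inv i m' →
      Achieves body m' T fun m'' => Inv (i + 1) (m''.setNat x (i + 1))) :
    Achieves (forLoop x N body) m (m.nat N * (T + 2) + 2) (Inv (m.nat N)) := by
  have hl2 : (CliqueCert.forLoop x N body).avoids (.nat 2) = true :=
    (forLoop_avoids ..).2 ⟨Loc.nat_differs_nat hx2, hb2⟩
  have hlN : (CliqueCert.forLoop x N body).avoids (.nat N) = true :=
    (forLoop_avoids ..).2 ⟨Loc.nat_differs_nat hxN, hbN⟩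
  have loop : ∀ d i m', i + d = m.nat N → Frame (CliqueCert.forLoop x N body) m m' →
      m'.nat x = i → Inv i m' →
      Achieves (.while (.natLt x N) (.seq body (.instr (.natAdd x x 2)))) m' (d * (T + 2) + 1)
        (Inv (m.nat N)) := by
    intro d
    induction d with
    | zero =>
      intro i m' hd hF hx hI
      have hN := hF.nat N hlN
      refine ⟨1, m', .whileFalse ?_, by omega, ?_⟩
      · simp only [Test.Holds, hN, hx]; omega
      · rwa [← hd]
    | succ d ih =>
      intro i m' hd hF hx hI
      obtain ⟨t, m₁, hr, ht, hm⟩ := step i m' (by omega) hF hx hI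
      have hx1 : m₁.nat x = i := (hr.frame.nat x hbx).trans hx
      have h21 : m₁.nat 2 = 1 := by rw [hr.frame.nat 2 hb2, hF.nat 2 hl2, h2]
      have hstep : Runs (.seq body (.instr (.natAdd x x 2))) m' (t + 1) (m₁.setNat x (i + 1)) := by
        refine .seq hr (.instr ?_)
        simp only [Instr.exec, State.setNat, hx1, h21]
      have hF' : Frame (CliqueCert.forLoop x N body) m (m₁.setNat x (i + 1)) :=
        hF.trans (hstep.frame.mono fun l hl => by
          rw [forLoop_avoids] at hl
          simp [Program.avoids, Instr.target, hl.1, hl.2])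
      obtain ⟨u, m₂, hr2, hu, hm2⟩ := ih (i + 1) _ (by omega) hF' (by simp) hm
      refine ⟨(t + 1) + u + 1, m₂, .whileTrue ?_ hstep hr2, ?_, hm2⟩
      · simp only [Test.Holds, hF.nat N hlN, hx]; omega
      · rw [Nat.succ_mul]; omega
  have hF0 : Frame (CliqueCert.forLoop x N body) m (m.setNat x 0) := by
    have hr : Runs (.instr (.natConst x 0)) m 1 (m.setNat x 0) := .instr rfl
    exact hr.frame.mono fun l hl => ((forLoop_avoids ..).1 hl).1
  obtain ⟨t, m', hr, ht, hm⟩ := loop (m.nat N) 0 _ (by omega) hF0 (by simp) h0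
  exact ⟨1 + t, m', .seq (.instr rfl) hr, by omega, hm⟩

/-- Loops of at most `X` rounds raise a polynomial time bound by one degree. -/
theorem Achieves.forLoop_poly {x N : ℕ} {body : Program} {m : State} {X c e : ℕ}
    (hX : 1 ≤ X) (hNX : m.nat N ≤ X) (Inv : ℕ → State → Prop) (h2 : m.nat 2 = 1)
    (h0 : Inv 0 (m.setNat x 0))
    (step : ∀ i m', i < m.nat N → Frame (CliqueCert.forLoop x N body) m m' → m'.nat x = i →
      Inv i m' → Achieves body m' (c * X ^ e) fun m'' => Inv (i + 1) (m''.setNat x (i + 1)))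
    (hbx : body.avoids (.nat x) = true := by rfl) (hbN : body.avoids (.nat N) = true := by rfl)
    (hb2 : body.avoids (.nat 2) = true := by rfl) (hxN : x ≠ N := by decide)
    (hx2 : x ≠ 2 := by decide) :
    Achieves (CliqueCert.forLoop x N body) m ((c + 4) * X ^ (e + 1)) (Inv (m.nat N)) := by
  refine (Achieves.forLoop Inv hbx hbN hb2 hxN hx2 h2 h0 step).weaken ?_ fun _ _ h => h
  have h1 : 1 ≤ X ^ e := Nat.one_le_pow _ _ hX
  calc m.nat N * (c * X ^ e + 2) + 2 ≤ X * (c * X ^ e + 2) + 2 := by gcongr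
    _ ≤ X * (c * X ^ e + 2 * X ^ e) + 2 * (X * X ^ e) := by
      gcongr
      · omega
      · have := Nat.mul_le_mul hX h1
        omega
    _ = (c + 4) * X ^ (e + 1) := by ring

/-- `z := y * x`, by repeated addition, with loop counter `t`. -/
def mulNat (z x y t : ℕ) : Program :=
  .seq (.instr (.natConst z 0)) (forLoop t y (.instr (.natAdd z z x)))

theorem Achieves.mulNat {z x y t : ℕ} {m : State} {X : ℕ} (hX : 1 ≤ X) (hy : m.nat y ≤ X)
    (h2 : m.nat 2 = 1) (hzx : z ≠ x := by decide) (hzy : z ≠ y := by decide)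
    (hzt : z ≠ t := by decide) (hxt : t ≠ x := by decide) (hyt : t ≠ y := by decide)
    (hz2 : z ≠ 2 := by decide) (ht2 : t ≠ 2 := by decide) :
    Achieves (mulNat z x y t) m (6 * X) fun m' => m'.nat z = m.nat y * m.nat x := by
  refine Achieves.weaken (T := 1 + (1 + 4) * X ^ (0 + 1)) ?_ (by simp; omega) fun _ _ h => h
  refine Achieves.seq (R := fun m' => m' = m.setNat z 0) ⟨1, _, .instr rfl, le_rfl, rfl⟩ ?_
  rintro m₀ - rfl
  have hy0 : (m.setNat z 0).nat y = m.nat y := by simp [hzy.symm]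
  rw [← hy0]
  refine Achieves.forLoop_poly (x := t) (N := y) hX (by rwa [hy0])
    (fun i m' => m'.nat z = i * m.nat x) (by simp [hz2.symm, h2]) (by simp [hzt]) ?_ ?_ ?_ ?_
    hyt ht2
  · intro i m' _ hF _ hI
    have hFx : m'.nat x = m.nat x := by
      rw [hF.nat x ((forLoop_avoids ..).2
        ⟨Loc.nat_differs_nat hxt, Loc.nat_differs_nat hzx⟩)]
      simp [hzx.symm]
    refine ⟨1, _, .instr rfl, by simp, ?_⟩
    simp [hzt, hI, hFx]
    ring
  · exact Loc.nat_differs_nat hzt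
  · exact Loc.nat_differs_nat hzy
  · exact Loc.nat_differs_nat hz2


/-! ### Filling a square matrix -/

/-- Fill the real array `a`, read as a square matrix of size `D` (the natural variable `4`) whose
entry in row `i` and column `l` is stored at `D * l + i`. The program `E` computes the entry into
the real variable `r`; it finds `i`, `l`, `D * l` and `D * l + i` in the natural variables `5`, `6`,
`7` and `8`. -/
def fillMat (a r : ℕ) (E : Program) : Program :=
  forLoop 6 4 (.seq (mulNat 7 6 4 9)
    (forLoop 5 4 (.seq (.instr (.natAdd 8 7 5)) (.seq E (.instr (.realStore a 8 r))))))

theorem Achieves.fillMat {a r : ℕ} {E : Program} {m : State} {D X c e : ℕ} (v : ℕ → ℕ → ℝ)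
    (hX : 1 ≤ X) (hD : m.nat 4 = D) (hDX : D ≤ X) (h2 : m.nat 2 = 1)
    (hE : ∀ i l m', i < D → l < D → Frame (fillMat a r E) m m' → m'.nat 5 = i → m'.nat 6 = l →
      m'.nat 7 = D * l → m'.nat 8 = D * l + i →
      Achieves E m' (c * X ^ e) fun m'' => m''.real r = v i l)
    (hE2 : E.avoids (.nat 2) = true := by rfl) (hE4 : E.avoids (.nat 4) = true := by rfl)
    (hE5 : E.avoids (.nat 5) = true := by rfl) (hE6 : E.avoids (.nat 6) = true := by rfl)
    (hE7 : E.avoids (.nat 7) = true := by rfl) (hE8 : E.avoids (.nat 8) = true := by rfl)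
    (hEa : E.avoids (.realArr a) = true := by rfl) :
    Achieves (fillMat a r E) m ((c + 16) * X ^ (e + 2)) fun m' =>
      ∀ i l, i < D → l < D → m'.realArr a (D * l + i) = v i l := by
  have hXe : 1 ≤ X ^ e := Nat.one_le_pow _ _ hX
  have hXe1 : X ≤ X ^ (e + 1) := Nat.le_self_pow (by omega) X
  set V : ℕ → ℝ := fun q => v (q % D) (q / D) with hV
  have hav : ∀ x, E.avoids (.nat x) = true → 5 ≠ x → 6 ≠ x → 7 ≠ x → 8 ≠ x → 9 ≠ x →
      (CliqueCert.fillMat a r E).avoids (.nat x) = true := by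
    intro x h h5 h6 h7 h8 h9
    simp [CliqueCert.fillMat, CliqueCert.forLoop, CliqueCert.mulNat, Program.avoids, Instr.target,
      Loc.differs, h, h5, h6, h7, h8, h9]
  have main : Achieves (CliqueCert.fillMat a r E) m ((c + 12 + 4) * X ^ (e + 1 + 1))
      fun m' => ∀ q < D * m.nat 4, m'.realArr a q = V q := by
    refine Achieves.forLoop_poly hX (by rwa [hD]) (fun l m' => ∀ q < D * l, m'.realArr a q = V q)
      h2 (by simp) ?_ ?_ ?_ ?_
    · intro l m₁ hl hF1 h6 hI
      rw [hD] at hl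
      have h42 := hF1.nat 2 (hav 2 hE2 (by decide) (by decide) (by decide) (by decide) (by decide))
      have h44 := hF1.nat 4 (hav 4 hE4 (by decide) (by decide) (by decide) (by decide) (by decide))
      refine Achieves.weaken (T := 6 * X + (c + 2 + 4) * X ^ (e + 1)) (U := (c + 12) * X ^ (e + 1))
        (R := fun m' => ∀ q < D * l + D, m'.realArr a q = V q) ?_ ?_ ?_
      · refine Achieves.seq (Achieves.mulNat hX (by rw [h44, hD]; exact hDX) (by rw [h42, h2])) ?_
        intro m₂ hF2 h7
        have h2' : m₂.nat 2 = 1 := by rw [hF2.nat 2, h42, h2]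
        have h4' : m₂.nat 4 = D := by rw [hF2.nat 4, h44, hD]
        have h6' : m₂.nat 6 = l := by rw [hF2.nat 6, h6]
        have h7' : m₂.nat 7 = D * l := by rw [h7, h44, hD, h6]
        have hI' : ∀ q < D * l, m₂.realArr a q = V q := by
          rw [hF2.realArr a]; exact hI
        have hloop := Achieves.forLoop_poly (x := 5) (N := 4)
          (body := .seq (.instr (.natAdd 8 7 5)) (.seq E (.instr (.realStore a 8 r)))) (m := m₂)
          (c := c + 2) (e := e) hX (by rw [h4']; exact hDX)
          (fun i m' => ∀ q < D * l + i, m'.realArr a q = V q) h2'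
          (by simpa using hI') ?_ ?_ ?_ ?_
        · exact hloop.weaken le_rfl fun m' _ h => by rwa [h4'] at h
        · intro i m₃ hi hF3 h5 hI3
          rw [h4'] at hi
          have hr4 : Runs (.instr (.natAdd 8 7 5)) m₃ 1
            (m₃.setNat 8 (m₃.nat 7 + m₃.nat 5)) := .instr rfl
          set m₄ := m₃.setNat 8 (m₃.nat 7 + m₃.nat 5) with hm4
          have h47 : m₃.nat 7 = D * l := by
            rw [hF3.nat 7 (by simp [CliqueCert.forLoop, Program.avoids, Instr.target,
              Loc.differs, hE7]), h7']
          have h46 : m₃.nat 6 = l := by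
            rw [hF3.nat 6 (by simp [CliqueCert.forLoop, Program.avoids, Instr.target,
              Loc.differs, hE6]), h6']
          have h48 : m₄.nat 8 = D * l + i := by simp [hm4, h47, h5]
          have hF4 : Frame (CliqueCert.fillMat a r E) m m₄ := by
            refine hF1.trans (.trans (hF2.mono ?_) (.trans (hF3.mono ?_) (hr4.frame.mono ?_)))
            all_goals
              intro x hx
              simp only [CliqueCert.forLoop, Program.avoids,
                Bool.and_eq_true] at hx ⊢
              tauto
          have hEm := hE i l m₄ hi hl hF4 (by simp [hm4, h5]) (by simp [hm4, h46])
            (by simp [hm4, h47]) h48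
          refine Achieves.weaken (T := 1 + (c * X ^ e + 1)) ?_ ?_ fun _ _ h => h
          · refine Achieves.seq (R := fun m' => m' = m₄) ⟨1, _, hr4, le_rfl, rfl⟩ ?_
            rintro _ - rfl
            refine hEm.seq fun m₅ hF5 hr5 => ⟨1, _, .instr rfl, le_rfl, ?_⟩
            intro q hq
            simp only [State.setNat_realArr, setEntry, Function.update_self,
              Function.update_apply, hF5.nat 8 hE8, h48, hF5.realArr a hEa]
            split_ifs with hqi
            · rw [hr5, hV, hqi]
              simp only [Nat.mul_add_mod, Nat.mod_eq_of_lt hi]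
              rw [Nat.mul_add_div (by omega), Nat.div_eq_of_lt hi, Nat.add_zero]
            · rw [hm4, State.setNat_realArr]
              exact hI3 q (by omega)
          · nlinarith
        · simp [Program.avoids, Instr.target, Loc.differs, hE5]
        · simp [Program.avoids, Instr.target, Loc.differs, hE4]
        · simp [Program.avoids, Instr.target, Loc.differs, hE2]
      · nlinarith
      · intro m' _ h q hq
        exact h q (by rw [Nat.mul_succ] at hq; exact hq)
    · simp [CliqueCert.forLoop, CliqueCert.mulNat, Program.avoids, Instr.target, Loc.differs, hE6]
    · simp [CliqueCert.forLoop, CliqueCert.mulNat, Program.avoids, Instr.target, Loc.differs, hE4]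
    · simp [CliqueCert.forLoop, CliqueCert.mulNat, Program.avoids, Instr.target, Loc.differs, hE2]
  refine main.weaken le_rfl fun m' _ h i l hi hl => ?_
  rw [h, hV]
  · simp only [Nat.mul_add_mod, Nat.mod_eq_of_lt hi]
    rw [Nat.mul_add_div (by omega), Nat.div_eq_of_lt hi, Nat.add_zero]
  · rw [hD]
    calc D * l + i < D * l + D := by omega
      _ = D * (l + 1) := by ring
      _ ≤ D * D := Nat.mul_le_mul_left _ hl


/-! ### The matrix of edge weights, indexed by tuples -/

/-- Split the natural variable `20` into its last base-`n` digit (left in `20`) and the rest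
(left in `23`). The value of variable `8` bounds the number of subtractions. -/
def popDigit : Program :=
  .seq (.instr (.natConst 23 0))
    (forLoop 24 8 (.ite (.natLt 20 0) skip (block [.natSub 20 20 0, .natAdd 23 23 2])))

theorem achieves_popDigit {m : State} {X : ℕ} (hX : 1 ≤ X) (h8 : m.nat 8 ≤ X)
    (h20 : m.nat 20 ≤ m.nat 8) (h0 : 0 < m.nat 0) (h2 : m.nat 2 = 1) :
    Achieves popDigit m (8 * X) fun m' =>
      m'.nat 20 = m.nat 20 % m.nat 0 ∧ m'.nat 23 = m.nat 20 / m.nat 0 := by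
  refine Achieves.weaken (T := 1 + (3 + 4) * X ^ (0 + 1))
    (R := fun m' => m'.nat 20 + m.nat 0 * m'.nat 23 = m.nat 20 ∧
      (m'.nat 20 < m.nat 0 ∨ m'.nat 23 = m.nat 8)) ?_ (by simp; omega) ?_
  · refine Achieves.seq (R := fun m' => m' = m.setNat 23 0) ⟨1, _, .instr rfl, le_rfl, rfl⟩ ?_
    rintro _ - rfl
    have := Achieves.forLoop_poly (x := 24) (N := 8)
      (body := .ite (.natLt 20 0) skip (block [.natSub 20 20 0, .natAdd 23 23 2]))
      (m := m.setNat 23 0) (c := 3) (e := 0) hX (by simpa using h8)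
      (fun i m' => m'.nat 20 + m.nat 0 * m'.nat 23 = m.nat 20 ∧
        (m'.nat 20 < m.nat 0 ∨ m'.nat 23 = i)) (by simpa using h2) (by simp) ?_
    · simpa using this
    · intro i m₁ _ hF _ ⟨hI1, hI2⟩
      have e0 : m₁.nat 0 = m.nat 0 := by rw [hF.nat 0]; simp
      have e2 : m₁.nat 2 = 1 := by rw [hF.nat 2]; simpa using h2
      refine (Achieves.ite (T := 2) ?_ ?_).weaken (by simp) fun _ _ h => h
      · intro hb
        simp only [Test.Holds, e0] at hb
        refine (Achieves.skip ?_).weaken (by simp) fun _ _ h => h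
        simp [hI1, hb]
      · intro hb
        simp only [Test.Holds, e0] at hb
        refine (Achieves.block (by simp) rfl ?_)
        have h23 : m₁.nat 23 = i := by omega
        simp only [State.setNat_nat, Function.update_apply]
        simp [e0, e2, h23]
        rw [h23] at hI1
        rw [Nat.mul_succ]
        omega
  · rintro m' - ⟨h1, h3⟩
    have hlt : m'.nat 20 < m.nat 0 := by
      rcases h3 with h | h
      · exact h
      · by_contra hge
        rw [h] at h1
        have := Nat.le_mul_of_pos_left (m.nat 8) h0
        omega
    rw [← h1]
    constructor
    · rw [Nat.add_mul_mod_self_left, Nat.mod_eq_of_lt hlt]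
    · rw [Nat.add_mul_div_left _ _ h0, Nat.div_eq_of_lt hlt, Nat.zero_add]

/-- Store the last `k` base-`n` digits of variable `8` in the natural array `1`. -/
def loadDigits : Program :=
  .seq (.instr (.natAdd 20 8 3))
    (forLoop 22 1 (.seq popDigit (block [.natStore 1 22 20, .natAdd 20 23 3])))

theorem achieves_loadDigits {m : State} {X : ℕ} (hX : 1 ≤ X) (h8 : m.nat 8 ≤ X)
    (h1 : m.nat 1 ≤ X) (h0 : 0 < m.nat 0) (h2 : m.nat 2 = 1) (h3 : m.nat 3 = 0) :
    Achieves loadDigits m (15 * X ^ 2) fun m' =>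
      ∀ b < m.nat 1, m'.natArr 1 b = m.nat 8 / m.nat 0 ^ b % m.nat 0 := by
  refine Achieves.weaken (T := 1 + (10 + 4) * X ^ (1 + 1))
    (R := fun m' => (∀ b < m.nat 1, m'.natArr 1 b = m.nat 8 / m.nat 0 ^ b % m.nat 0) ∧
      m'.nat 20 = m.nat 8 / m.nat 0 ^ m.nat 1) ?_ ?_ fun _ _ h => h.1
  · refine Achieves.seq (R := fun m' => m' = m.setNat 20 (m.nat 8 + m.nat 3))
      ⟨1, _, .instr rfl, le_rfl, rfl⟩ ?_
    rintro _ - rfl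
    have := Achieves.forLoop_poly (x := 22) (N := 1)
      (body := .seq popDigit (block [.natStore 1 22 20, .natAdd 20 23 3]))
      (m := m.setNat 20 (m.nat 8 + m.nat 3)) (c := 10) (e := 1) hX (by simpa using h1)
      (fun i m' => (∀ b < i, m'.natArr 1 b = m.nat 8 / m.nat 0 ^ b % m.nat 0) ∧
        m'.nat 20 = m.nat 8 / m.nat 0 ^ i) (by simpa using h2) (by simp [h3]) ?_
    · simpa using this
    · intro i m₁ hi hF h22 ⟨hI1, hI2⟩
      have e0 : m₁.nat 0 = m.nat 0 := by rw [hF.nat 0]; simp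
      have e2 : m₁.nat 2 = 1 := by rw [hF.nat 2]; simpa using h2
      have e8 : m₁.nat 8 = m.nat 8 := by rw [hF.nat 8]; simp
      have e3 : m₁.nat 3 = 0 := by rw [hF.nat 3]; simpa using h3
      refine Achieves.weaken (T := 8 * X + 2) ?_ (by rw [pow_one]; omega) fun _ _ h => h
      refine (achieves_popDigit hX (by rwa [e8]) ?_ (by rwa [e0]) e2).seq ?_
      · rw [hI2, e8]; exact Nat.div_le_self _ _
      · intro m₂ hF2 ⟨h20, h23⟩
        have f22 : m₂.nat 22 = i := by rw [hF2.nat 22, h22]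
        have f3 : m₂.nat 3 = 0 := by rw [hF2.nat 3, e3]
        have f1 : m₂.natArr 1 = m₁.natArr 1 := hF2.natArr 1
        refine (Achieves.block (by simp) rfl ?_)
        rw [e0, hI2] at h20 h23
        simp only [State.setNat_nat, State.setNat_natArr, setEntry, Function.update_apply]
        simp only [f22, f3, f1, h20, h23]
        constructor
        · intro b hb
          by_cases hbi : b = i
          · simp [hbi]
          · simpa [hbi] using hI1 b (by omega)
        · simp [Nat.div_div_eq_div_mul, pow_succ]
  · have : 1 ≤ X ^ 2 := Nat.one_le_pow _ _ hX
    norm_num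
    omega

/-- Set variable `21` to `0` if two of the first `k` entries of the natural array `1` agree, and to
`1` otherwise. -/
def checkDistinct : Program :=
  .seq (.instr (.natConst 21 1))
    (forLoop 22 1 (.seq (.instr (.natLoad 25 1 22))
      (forLoop 24 22 (.seq (.instr (.natLoad 26 1 24))
        (.ite (.natLt 25 26) skip (.ite (.natLt 26 25) skip (.instr (.natConst 21 0))))))))

theorem achieves_checkDistinct {m : State} {X : ℕ} (hX : 1 ≤ X) (h1 : m.nat 1 ≤ X)
    (h2 : m.nat 2 = 1) :
    Achieves checkDistinct m (14 * X ^ 2) fun m' =>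
      (m'.nat 21 < 1 ↔ ∃ b < m.nat 1, ∃ a < b, m.natArr 1 a = m.natArr 1 b) := by
  refine Achieves.weaken (T := 1 + (9 + 4) * X ^ (1 + 1))
    (R := fun m' => (m'.nat 21 < 1 ↔ ∃ b < m.nat 1, ∃ a < b, m.natArr 1 a = m.natArr 1 b))
    ?_ ?_ fun _ _ h => h
  · refine Achieves.seq (R := fun m' => m' = m.setNat 21 1)
      ⟨1, _, .instr rfl, le_rfl, rfl⟩ ?_
    rintro _ - rfl
    have := Achieves.forLoop_poly (x := 22) (N := 1)
      (body := .seq (.instr (.natLoad 25 1 22))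
        (forLoop 24 22 (.seq (.instr (.natLoad 26 1 24))
        (.ite (.natLt 25 26) skip (.ite (.natLt 26 25) skip (.instr (.natConst 21 0)))))))
      (m := m.setNat 21 1) (c := 9) (e := 1) hX (by simpa using h1)
      (fun i m' => (m'.nat 21 < 1 ↔ ∃ b < i, ∃ a < b, m.natArr 1 a = m.natArr 1 b))
      (by simpa using h2) (by simp) ?_
    · simpa using this
    · intro i m₁ hi hF h22 hI
      simp only [State.setNat_nat] at hi
      norm_num at hi
      have e2 : m₁.nat 2 = 1 := by rw [hF.nat 2]; simpa using h2
      have eA : m₁.natArr 1 = m.natArr 1 := by rw [hF.natArr 1]; simp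
      refine Achieves.weaken (T := 1 + (4 + 4) * X ^ (0 + 1))
        (R := fun m' => (m'.nat 21 < 1 ↔ (∃ b < i, ∃ a < b, m.natArr 1 a = m.natArr 1 b) ∨
          ∃ a < i, m.natArr 1 a = m.natArr 1 i)) ?_ (by norm_num; omega) ?_
      · refine Achieves.seq (R := fun m' => m' = m₁.setNat 25 (m₁.natArr 1 (m₁.nat 22)))
          ⟨1, _, .instr rfl, le_rfl, rfl⟩ ?_
        rintro _ - rfl
        have hloop := Achieves.forLoop_poly (x := 24) (N := 22)
          (body := .seq (.instr (.natLoad 26 1 24))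
            (.ite (.natLt 25 26) skip (.ite (.natLt 26 25) skip (.instr (.natConst 21 0)))))
          (m := m₁.setNat 25 (m₁.natArr 1 (m₁.nat 22))) (c := 4) (e := 0) hX
          (by simp [h22]; omega)
          (fun i' m' => (m'.nat 21 < 1 ↔ (∃ b < i, ∃ a < b, m.natArr 1 a = m.natArr 1 b) ∨
            ∃ a < i', m.natArr 1 a = m.natArr 1 i)) (by simpa using e2) (by simpa using hI) ?_
        · simpa [h22] using hloop
        · intro i' m₂ _ hF2 h24 hI2
          have g25 : m₂.nat 25 = m.natArr 1 i := by rw [hF2.nat 25]; simp [eA, h22]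
          have gA : m₂.natArr 1 = m.natArr 1 := by rw [hF2.natArr 1]; simp [eA]
          have hsplit : (∃ a < i' + 1, m.natArr 1 a = m.natArr 1 i) ↔
              (∃ a < i', m.natArr 1 a = m.natArr 1 i) ∨ m.natArr 1 i' = m.natArr 1 i := by
            simp only [Nat.lt_succ_iff_lt_or_eq, or_and_right, exists_or, exists_eq_left]
          refine Achieves.weaken (T := 1 + (1 + 1 + 1)) ?_ (by simp) fun _ _ h => h
          refine Achieves.seq (R := fun m' => m' = m₂.setNat 26 (m₂.natArr 1 (m₂.nat 24)))
            ⟨1, _, .instr rfl, le_rfl, rfl⟩ ?_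
          rintro _ - rfl
          simp only [hsplit, ← or_assoc]
          refine Achieves.ite ?_ ?_
          · intro hb
            simp only [Test.Holds, State.setNat_nat, gA, g25, h24] at hb
            norm_num at hb
            refine (Achieves.skip ?_).weaken (by simp) fun _ _ h => h
            simp [hI2, hb.ne']
          · intro hb
            simp only [Test.Holds, State.setNat_nat, gA, g25, h24] at hb
            norm_num at hb
            refine Achieves.ite ?_ ?_
            · intro hb'
              simp only [Test.Holds, State.setNat_nat, gA, g25, h24] at hb'
              norm_num at hb'
              refine Achieves.skip ?_
              simp [hI2, hb'.ne]
            · intro hb'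
              simp only [Test.Holds, State.setNat_nat, gA, g25, h24] at hb'
              norm_num at hb'
              refine ⟨1, _, .instr rfl, le_rfl, ?_⟩
              simp [le_antisymm hb hb']
      · intro m' _ h
        show (m'.setNat 22 (i + 1)).nat 21 < 1 ↔ _
        rw [show (m'.setNat 22 (i + 1)).nat 21 = m'.nat 21 by simp, h]
        simp only [Nat.lt_succ_iff_lt_or_eq, or_and_right, exists_or, exists_eq_left]
  · have : 1 ≤ X ^ 2 := Nat.one_le_pow _ _ hX
    norm_num
    omega

open Classical in
/-- The weight `bit j - p` of the tuple encoded by `j` in base `n`; it is `0` if the tuple is not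
injective. -/
noncomputable def tupleWeight (n k : ℕ) (bit : ℕ → ℕ) (p : ℝ) (j : ℕ) : ℝ :=
  if ∃ b < k, ∃ a < b, j / n ^ a % n = j / n ^ b % n then 0 else bit j - p

/-- Compute the weight of the tuple encoded by variable `8`. -/
def loadWeight : Program :=
  .seq loadDigits (.seq checkDistinct
    (.seq (block [.natLoad 27 0 8, .realOfNat 1 27, .realSub 1 1 0])
      (.ite (.natLt 21 2) (.instr (.realSub 1 1 1)) skip)))

theorem achieves_loadWeight {m : State} {X : ℕ} (hX : 1 ≤ X) (h8 : m.nat 8 ≤ X)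
    (h1 : m.nat 1 ≤ X) (h0 : 0 < m.nat 0) (h2 : m.nat 2 = 1) (h3 : m.nat 3 = 0) :
    Achieves loadWeight m (34 * X ^ 2) fun m' =>
      m'.real 1 = tupleWeight (m.nat 0) (m.nat 1) (m.natArr 0) (m.real 0) (m.nat 8) := by
  refine Achieves.weaken (T := 15 * X ^ 2 + (14 * X ^ 2 + (3 + (1 + 1)))) ?_ ?_ fun _ _ h => h
  · refine (achieves_loadDigits hX h8 h1 h0 h2 h3).seq fun m₁ hF1 hd => ?_
    have e1 : m₁.nat 1 = m.nat 1 := hF1.nat 1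
    refine (achieves_checkDistinct hX (by rwa [e1]) (by rw [hF1.nat 2, h2])).seq
      fun m₂ hF2 hc => ?_
    have f8 : m₂.nat 8 = m.nat 8 := by rw [hF2.nat 8, hF1.nat 8]
    have f2 : m₂.nat 2 = 1 := by rw [hF2.nat 2, hF1.nat 2, h2]
    have fA : m₂.natArr 0 = m.natArr 0 := by rw [hF2.natArr 0, hF1.natArr 0]
    have fp : m₂.real 0 = m.real 0 := by rw [hF2.real 0, hF1.real 0]
    have hc' : m₂.nat 21 < 1 ↔ ∃ b < m.nat 1, ∃ a < b,
        m.nat 8 / m.nat 0 ^ a % m.nat 0 = m.nat 8 / m.nat 0 ^ b % m.nat 0 := by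
      rw [hc, e1]
      refine exists_congr fun b => and_congr_right fun hb => exists_congr fun a =>
        and_congr_right fun ha => ?_
      rw [hd a (ha.trans hb), hd b hb]
    refine Achieves.seq (T := 3) (R := fun m' => m'.real 1 = m.natArr 0 (m.nat 8) - m.real 0)
      (Achieves.block (by simp) rfl ?_) fun m₃ hF3 hr => ?_
    · simp [f8, fA, fp]
    · have g21 : m₃.nat 21 = m₂.nat 21 := hF3.nat 21
      have g2 : m₃.nat 2 = 1 := by rw [hF3.nat 2, f2]
      refine Achieves.ite ?_ ?_
      · intro hb
        simp only [Test.Holds, g21, g2] at hb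
        refine ⟨1, _, .instr rfl, le_rfl, ?_⟩
        simp [tupleWeight, if_pos (hc'.1 hb)]
      · intro hb
        simp only [Test.Holds, g21, g2] at hb
        refine Achieves.skip ?_
        rw [tupleWeight, if_neg fun h => hb (hc'.2 h)]
        simpa using hr
  · have : 1 ≤ X ^ 2 := Nat.one_le_pow _ _ hX
    omega

/-- Fill the real array `1` with the matrix of the weights of all `k`-tuples. -/
def fillWeights : Program := fillMat 1 1 loadWeight

theorem achieves_fillWeights {m : State} {X D : ℕ} (hX : 1 ≤ X) (hD : m.nat 4 = D)
    (hDX : D * D ≤ X) (h1 : m.nat 1 ≤ X) (h0 : 0 < m.nat 0) (h2 : m.nat 2 = 1)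
    (h3 : m.nat 3 = 0) :
    Achieves fillWeights m (50 * X ^ 4) fun m' => ∀ i l, i < D → l < D →
      m'.realArr 1 (D * l + i) =
        tupleWeight (m.nat 0) (m.nat 1) (m.natArr 0) (m.real 0) (D * l + i) := by
  have hDX' : D ≤ X := (Nat.le_mul_self D).trans hDX
  refine Achieves.fillMat (c := 34) (e := 2)
    (fun i l => tupleWeight (m.nat 0) (m.nat 1) (m.natArr 0) (m.real 0) (D * l + i))
    hX hD hDX' h2 fun i l m' hi hl hF _ _ _ h8 => ?_
  have e0 : m'.nat 0 = m.nat 0 := hF.nat 0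
  have e1 : m'.nat 1 = m.nat 1 := hF.nat 1
  have hidx : D * l + i ≤ X := by
    calc D * l + i ≤ D * l + D := by omega
      _ = D * (l + 1) := by ring
      _ ≤ D * D := Nat.mul_le_mul_left _ hl
      _ ≤ X := hDX
  have := achieves_loadWeight (m := m') hX (by rwa [h8]) (by rwa [e1]) (by rwa [e0])
    (by rw [hF.nat 2, h2]) (by rw [hF.nat 3, h3])
  rw [e0, e1, h8, hF.natArr 0, hF.real 0] at this
  exact this


/-! ### The Gram matrix and the elimination -/

/-- Compute the inner product of two columns of the matrix in the real array `1`. -/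
def loadGram : Program :=
  .seq (.instr (.realSub 1 1 1)) (.seq (mulNat 20 5 4 9)
    (forLoop 22 4 (block [.natAdd 23 20 22, .natAdd 24 7 22, .realLoad 2 1 23, .realLoad 3 1 24,
      .realMul 2 2 3, .realAdd 1 1 2])))

/-- Fill the real array `2` with the Gram matrix of the columns of the matrix in array `1`. -/
def fillGram : Program := fillMat 2 1 loadGram

theorem achieves_fillGram {m : State} {X D : ℕ} (hX : 1 ≤ X) (hD : m.nat 4 = D)
    (hDX : D ≤ X) (h2 : m.nat 2 = 1) :
    Achieves fillGram m (33 * X ^ 3) fun m' => ∀ i l, i < D → l < D →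
      m'.realArr 2 (D * l + i) =
        ∑ w ∈ Finset.range D, m.realArr 1 (D * i + w) * m.realArr 1 (D * l + w) := by
  refine Achieves.fillMat (c := 17) (e := 1)
    (fun i l => ∑ w ∈ Finset.range D, m.realArr 1 (D * i + w) * m.realArr 1 (D * l + w))
    hX hD hDX h2 fun i l m' hi hl hF h5 h6 h7 h8 => ?_
  have e2 : m'.nat 2 = 1 := by rw [hF.nat 2, h2]
  have e4 : m'.nat 4 = D := by rw [hF.nat 4, hD]
  have eA : m'.realArr 1 = m.realArr 1 := hF.realArr 1
  refine Achieves.weaken (T := 1 + (6 * X + (6 + 4) * X ^ (0 + 1))) ?_ (by norm_num; omega)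
    fun _ _ h => h
  refine Achieves.seq (T := 1) (R := fun m' => m'.real 1 = 0)
    ⟨1, _, .instr rfl, le_rfl, by simp⟩ fun m₁ hF1 hr => ?_
  refine (Achieves.mulNat hX (by rw [hF1.nat 4, e4]; exact hDX) (by rw [hF1.nat 2, e2])).seq
    fun m₂ hF2 h20 => ?_
  have f4 : m₂.nat 4 = D := by rw [hF2.nat 4, hF1.nat 4, e4]
  have f20 : m₂.nat 20 = D * i := by rw [h20, hF1.nat 4, hF1.nat 5, e4, h5]
  have f7 : m₂.nat 7 = D * l := by rw [hF2.nat 7, hF1.nat 7, h7]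
  have fA : m₂.realArr 1 = m.realArr 1 := by rw [hF2.realArr 1, hF1.realArr 1, eA]
  have hloop := Achieves.forLoop_poly (x := 22) (N := 4)
    (body := block [.natAdd 23 20 22, .natAdd 24 7 22, .realLoad 2 1 23, .realLoad 3 1 24,
      .realMul 2 2 3, .realAdd 1 1 2])
    (m := m₂) (c := 6) (e := 0) hX (by rwa [f4])
    (fun t m' => m'.real 1 =
      ∑ w ∈ Finset.range t, m.realArr 1 (D * i + w) * m.realArr 1 (D * l + w))
    (by rw [hF2.nat 2, hF1.nat 2, e2]) (by simp [hF2.real 1, hr]) ?_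
  · rwa [f4] at hloop
  · intro t m₃ ht hF3 h22 hI
    have g20 : m₃.nat 20 = D * i := by rw [hF3.nat 20, f20]
    have g7 : m₃.nat 7 = D * l := by rw [hF3.nat 7, f7]
    have gA : m₃.realArr 1 = m.realArr 1 := by rw [hF3.realArr 1, fA]
    refine (Achieves.block (by simp) rfl ?_).weaken (by simp) fun _ _ h => h
    simp [h22, g20, g7, gA, hI, Finset.sum_range_succ]

/-- One step of the division-free symmetric elimination, with pivot in row and column `j`. -/
def eliminate (M : ℕ → ℕ → ℝ) (j : ℕ) : ℕ → ℕ → ℝ :=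
  fun i l => M j j * M i l - M i j * M j l

/-- The matrix after the elimination steps with pivots `0, …, j - 1`. -/
def eliminated (M : ℕ → ℕ → ℝ) : ℕ → ℕ → ℕ → ℝ
  | 0 => M
  | j + 1 => eliminate (eliminated M j) j

/-- Compute an entry of the matrix `α * 1 - β * G`, where `α` and `β` are the real variables `10`
and `11`, and `G` is the matrix in the real array `2`. The real variable `21` is `0`. -/
def loadShifted : Program :=
  .seq (block [.realLoad 1 2 8, .realMul 1 1 11, .realSub 1 21 1])
    (.ite (.natLt 5 6) skip (.ite (.natLt 6 5) skip (.instr (.realAdd 1 1 10))))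

theorem achieves_loadShifted {m : State} (h21 : m.real 21 = 0) :
    Achieves loadShifted m 6 fun m' =>
      m'.real 1 = (if m.nat 5 = m.nat 6 then m.real 10 else 0) -
        m.real 11 * m.realArr 2 (m.nat 8) := by
  refine Achieves.seq (T := 3) (U := 1 + 1 + 1)
    (R := fun m' => m'.real 1 = - (m.real 11 * m.realArr 2 (m.nat 8)))
    (Achieves.block (by simp) rfl ?_) fun m₁ hF hr => ?_
  · simp [h21, mul_comm]
  have e5 : m₁.nat 5 = m.nat 5 := hF.nat 5
  have e6 : m₁.nat 6 = m.nat 6 := hF.nat 6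
  refine Achieves.ite (fun hb => ?_) fun hb => ?_
  · simp only [Test.Holds, e5, e6] at hb
    refine (Achieves.skip ?_).weaken (by simp) fun _ _ h => h
    simp [hr, hb.ne]
  · refine Achieves.ite (fun hb' => ?_) fun hb' => ?_
    · simp only [Test.Holds, e5, e6] at hb'
      refine Achieves.skip ?_
      simp [hr, hb'.ne']
    · simp only [Test.Holds, e5, e6] at hb hb'
      refine ⟨1, _, .instr rfl, le_rfl, ?_⟩
      simp [hr, le_antisymm (not_lt.1 hb') (not_lt.1 hb), hF.real 10]
      ring

/-- Compute an entry of the result of the elimination step with the pivot in row and column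
`j` (variable `17`), for the matrix in the real array `3`; variable `18` is `D * j` and the real
variable `4` is the pivot. -/
def loadEliminated : Program :=
  block [.natAdd 20 18 5, .natAdd 21 7 17, .realLoad 1 3 8, .realMul 1 4 1, .realLoad 2 3 20,
    .realLoad 3 3 21, .realMul 2 2 3, .realSub 1 1 2]

/-- One elimination step on the matrix in the real array `3`, with a detour through array `4`.
Variable `16` is set to `0` if the pivot is not positive. -/
def eliminationStep : Program :=
  .seq (mulNat 18 17 4 9) (.seq (block [.natAdd 19 18 17, .realLoad 4 3 19])
    (.seq (.ite (.realLt 21 4) skip (.instr (.natConst 16 0)))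
      (.seq (fillMat 4 1 loadEliminated) (fillMat 3 1 (.instr (.realLoad 1 4 8))))))

/-- The result of an elimination step is first collected in array `4`, because the entries of the
pivot row and column are still needed while the matrix is overwritten. -/
theorem achieves_eliminationStep {m : State} {X D : ℕ} (M : ℕ → ℕ → ℝ) (hX : 1 ≤ X)
    (hD : m.nat 4 = D) (hDX : D ≤ X) (h2 : m.nat 2 = 1) (h21 : m.real 21 = 0)
    (hj : m.nat 17 < D) (hM : ∀ i l, i < D → l < D → m.realArr 3 (D * l + i) = M i l) :
    Achieves eliminationStep m (51 * X ^ 2) fun m' =>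
      (∀ i l, i < D → l < D → m'.realArr 3 (D * l + i) = eliminate M (m.nat 17) i l) ∧
        (m'.nat 16 < 1 ↔ m.nat 16 < 1 ∨ M (m.nat 17) (m.nat 17) ≤ 0) := by
  refine Achieves.weaken (T := 6 * X + (2 + ((1 + 1) + ((8 + 16) * X ^ (0 + 2) +
    (1 + 16) * X ^ (0 + 2))))) ?_ ?_ fun _ _ h => h
  swap
  · have : X ≤ X ^ 2 := Nat.le_self_pow (by omega) X
    norm_num
    omega
  set j := m.nat 17 with hjdef
  refine (Achieves.mulNat hX (by rwa [hD]) h2).seq fun m₁ hF1 h18 => ?_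
  refine Achieves.seq (T := 2) (R := fun m' => m'.real 4 = M j j)
    (Achieves.block (by simp) rfl ?_) fun m₂ hF2 h4 => ?_
  · simp [h18, hF1.realArr 3, hF1.nat 17, hD, ← hjdef, hM j j hj hj]
  have a21 : m₂.real 21 = 0 := by rw [hF2.real 21, hF1.real 21, h21]
  have a16 : m₂.nat 16 = m.nat 16 := by rw [hF2.nat 16, hF1.nat 16]
  refine Achieves.seq (T := 1 + 1)
    (R := fun m' => (m'.nat 16 < 1 ↔ m.nat 16 < 1 ∨ M j j ≤ 0)) ?_ fun m₃ hF3 h16 => ?_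
  · refine Achieves.ite (fun hb => ?_) fun hb => ?_
    · simp only [Test.Holds, a21, h4] at hb
      refine Achieves.skip ?_
      simp [a16, not_le.2 hb]
    · simp only [Test.Holds, a21, h4, not_lt] at hb
      refine ⟨1, _, .instr rfl, le_rfl, ?_⟩
      simp [hb]
  have b4 : m₃.nat 4 = D := by rw [hF3.nat 4, hF2.nat 4, hF1.nat 4, hD]
  have b2 : m₃.nat 2 = 1 := by rw [hF3.nat 2, hF2.nat 2, hF1.nat 2, h2]
  have b17 : m₃.nat 17 = j := by rw [hF3.nat 17, hF2.nat 17, hF1.nat 17]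
  have b18 : m₃.nat 18 = D * j := by rw [hF3.nat 18, hF2.nat 18, h18, hD]
  have br4 : m₃.real 4 = M j j := by rw [hF3.real 4, h4]
  have bA : m₃.realArr 3 = m.realArr 3 := by rw [hF3.realArr 3, hF2.realArr 3, hF1.realArr 3]
  refine (Achieves.fillMat (eliminate M j) hX b4 hDX b2 ?_).seq fun m₄ hF4 hA4 => ?_
  · intro i l m' hi hl hF h5 h6 h7 h8
    have c17 : m'.nat 17 = j := by rw [hF.nat 17, b17]
    have c18 : m'.nat 18 = D * j := by rw [hF.nat 18, b18]
    have cr4 : m'.real 4 = M j j := by rw [hF.real 4, br4]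
    have cA : m'.realArr 3 = m.realArr 3 := by rw [hF.realArr 3, bA]
    refine (Achieves.block (by simp) rfl ?_).weaken (by simp) fun _ _ h => h
    simp [h5, h7, h8, c17, c18, cr4, cA, hM i l hi hl, hM i j hi hj,
      hM j l hj hl, eliminate]
  have d4 : m₄.nat 4 = D := by rw [hF4.nat 4, b4]
  have d2 : m₄.nat 2 = 1 := by rw [hF4.nat 2, b2]
  refine (Achieves.fillMat (c := 1) (e := 0) (eliminate M j) hX d4 hDX d2 ?_).weaken le_rfl ?_
  · intro i l m' hi hl hF h5 h6 h7 h8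
    refine ⟨1, _, .instr rfl, by simp, ?_⟩
    simp [h8, hF.realArr 4, hA4 i l hi hl]
  · intro m₅ hF5 hA5
    refine ⟨hA5, ?_⟩
    rw [hF5.nat 16, hF4.nat 16, h16]

/-- Set variable `16` to `0` if one of the pivots of the matrix `α * 1 - β * G` is not positive,
and to `1` otherwise. -/
def testPivots : Program :=
  .seq (fillMat 3 1 loadShifted) (.seq (.instr (.natConst 16 1)) (forLoop 17 4 eliminationStep))

theorem achieves_testPivots {m : State} {X D : ℕ} (G : ℕ → ℕ → ℝ) (hX : 1 ≤ X)
    (hD : m.nat 4 = D) (hDX : D ≤ X) (h2 : m.nat 2 = 1) (h21 : m.real 21 = 0)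
    (hG : ∀ i l, i < D → l < D → m.realArr 2 (D * l + i) = G i l) :
    Achieves testPivots m (78 * X ^ 3) fun m' =>
      (m'.nat 16 < 1 ↔ ∃ j < D,
        eliminated (fun i l => (if i = l then m.real 10 else 0) - m.real 11 * G i l) j j j ≤ 0) := by
  set M : ℕ → ℕ → ℝ := fun i l => (if i = l then m.real 10 else 0) - m.real 11 * G i l with hMdef
  refine Achieves.weaken (T := (6 + 16) * X ^ (0 + 2) + (1 + (51 + 4) * X ^ (2 + 1)))
    (R := fun m' => (∀ i l, i < D → l < D → m'.realArr 3 (D * l + i) = eliminated M D i l) ∧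
      (m'.nat 16 < 1 ↔ ∃ j < D, eliminated M j j j ≤ 0)) ?_ ?_ fun _ _ h => h.2
  swap
  · have h1 : X ^ 2 ≤ X ^ 3 := Nat.pow_le_pow_right hX (by omega)
    have h3 : 1 ≤ X ^ 3 := Nat.one_le_pow _ _ hX
    norm_num
    omega
  refine (Achieves.fillMat M hX hD hDX h2 ?_).seq fun m₁ hF1 hA1 => ?_
  · intro i l m' hi hl hF h5 h6 h7 h8
    refine (achieves_loadShifted (by rw [hF.real 21, h21])).weaken (by simp) fun m'' _ h => ?_
    rw [h, h5, h6, h8, hF.real 10, hF.real 11, hF.realArr 2, hG i l hi hl]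
  refine Achieves.seq (T := 1) (R := fun m' => m' = m₁.setNat 16 1)
    ⟨1, _, .instr rfl, le_rfl, rfl⟩ ?_
  rintro _ - rfl
  have hloop := Achieves.forLoop_poly (x := 17) (N := 4) (body := eliminationStep)
    (m := m₁.setNat 16 1) (c := 51) (e := 2) hX (by simpa [hF1.nat 4, hD] using hDX)
    (fun i m' => (∀ a b, a < D → b < D → m'.realArr 3 (D * b + a) = eliminated M i a b) ∧
      (m'.nat 16 < 1 ↔ ∃ j < i, eliminated M j j j ≤ 0))
    (by simp [hF1.nat 2, h2]) (by simpa [eliminated] using hA1) ?_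
  · simpa [hF1.nat 4, hD] using hloop
  · intro i m₂ hi hF2 h17 ⟨hI1, hI2⟩
    have e4 : m₂.nat 4 = D := by rw [hF2.nat 4]; simp [hF1.nat 4, hD]
    have e2 : m₂.nat 2 = 1 := by rw [hF2.nat 2]; simp [hF1.nat 2, h2]
    have e21 : m₂.real 21 = 0 := by rw [hF2.real 21]; simp [hF1.real 21, h21]
    have hiD : i < D := by simpa [hF1.nat 4, hD] using hi
    refine (achieves_eliminationStep (eliminated M i) hX e4 hDX e2 e21 (by rwa [h17]) hI1).weaken
      le_rfl fun m₃ _ ⟨h1, h3⟩ => ?_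
    rw [h17] at h1 h3
    refine ⟨by simpa [eliminated] using h1, ?_⟩
    rw [show (m₃.setNat 17 (i + 1)).nat 16 = m₃.nat 16 by simp, h3, hI2]
    simp only [Nat.lt_succ_iff_lt_or_eq, or_and_right, exists_or, exists_eq_left]


/-! ### The program

The variables that keep their meaning throughout are the natural variables `0` (`n`), `1` (`k`), `2`
(the constant one), `3` (the constant zero), `4` (the size `n ^ (k / 2)` of the matrix) and `10`
(`k / 2`), and the real variables `0` (`p`) and `21` (the constant zero). The real arrays `1`, `2` and
`3` hold the matrix of tuple weights, its Gram matrix and the matrix under elimination. -/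

/-- Compute `k / 2` into variable `10` and `n ^ (k / 2)` into variable `4`. -/
def computeSizes : Program :=
  .seq (.instr (.natConst 10 0))
    (.seq (forLoop 11 1 (.seq (.instr (.natAdd 12 10 10))
      (.ite (.natLt 12 1) (.instr (.natAdd 10 10 2)) skip)))
    (.seq (.instr (.natConst 4 1))
      (forLoop 11 10 (.seq (mulNat 12 4 0 9) (.instr (.natAdd 4 12 3))))))

theorem achieves_computeSizes {m : State} {X : ℕ} (hX : 1 ≤ X) (h0 : m.nat 0 ≤ X)
    (h1 : m.nat 1 ≤ X) (hk : Even (m.nat 1)) (h2 : m.nat 2 = 1) (h3 : m.nat 3 = 0) :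
    Achieves computeSizes m (20 * X ^ 2) fun m' =>
      m'.nat 10 = m.nat 1 / 2 ∧ m'.nat 4 = m.nat 0 ^ (m.nat 1 / 2) := by
  set n := m.nat 0 with hn
  set k := m.nat 1 with hkdef
  have hk2 : k / 2 + k / 2 = k := by obtain ⟨r, hr⟩ := hk; omega
  refine Achieves.weaken (T := 1 + ((3 + 4) * X ^ (0 + 1) + (1 + (7 + 4) * X ^ (1 + 1))))
    ?_ ?_ fun _ _ h => h
  swap
  · have h : X ≤ X ^ 2 := Nat.le_self_pow (by omega) X
    norm_num
    omega
  refine Achieves.seq (R := fun m' => m' = m.setNat 10 0) ⟨1, _, .instr rfl, le_rfl, rfl⟩ ?_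
  rintro _ - rfl
  refine Achieves.seq (R := fun m' => m'.nat 10 = min k (k / 2)) ?_ fun m₂ hF2 h10 => ?_
  · have hloop := Achieves.forLoop_poly (x := 11) (N := 1)
      (body := .seq (.instr (.natAdd 12 10 10))
        (.ite (.natLt 12 1) (.instr (.natAdd 10 10 2)) skip))
      (m := m.setNat 10 0) (c := 3) (e := 0) hX (by simpa using h1)
      (fun i m' => m'.nat 10 = min i (k / 2)) (by simpa using h2) (by simp) ?_
    · simpa [← hkdef] using hloop
    · intro i m₁ _ hF _ hI
      have e1 : m₁.nat 1 = k := by rw [hF.nat 1]; simp [hkdef]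
      have e2 : m₁.nat 2 = 1 := by rw [hF.nat 2]; simpa using h2
      refine Achieves.weaken (T := 1 + (1 + 1)) ?_ (by simp) fun _ _ h => h
      refine Achieves.seq (R := fun m' => m' = m₁.setNat 12 (m₁.nat 10 + m₁.nat 10))
        ⟨1, _, .instr rfl, le_rfl, rfl⟩ ?_
      rintro _ - rfl
      refine Achieves.ite (fun hb => ?_) fun hb => ?_
      · simp [Test.Holds, e1, hI] at hb
        refine ⟨1, _, .instr rfl, le_rfl, ?_⟩
        simp [e2, hI]
        omega
      · simp [Test.Holds, e1, hI] at hb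
        refine Achieves.skip ?_
        simp [hI]
        omega
  · have f10 : m₂.nat 10 = k / 2 := by rw [h10]; omega
    have f0 : m₂.nat 0 = n := by rw [hF2.nat 0]; simp [hn]
    have f2 : m₂.nat 2 = 1 := by rw [hF2.nat 2]; simpa using h2
    have f3 : m₂.nat 3 = 0 := by rw [hF2.nat 3]; simpa using h3
    refine Achieves.seq (R := fun m' => m' = m₂.setNat 4 1) ⟨1, _, .instr rfl, le_rfl, rfl⟩ ?_
    rintro _ - rfl
    have hloop := Achieves.forLoop_poly (x := 11) (N := 10)
      (body := .seq (mulNat 12 4 0 9) (.instr (.natAdd 4 12 3)))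
      (m := m₂.setNat 4 1) (c := 7) (e := 1) hX (by simp [f10]; omega)
      (fun i m' => m'.nat 4 = n ^ i) (by simpa using f2) (by simp) ?_
    · refine hloop.weaken le_rfl fun m' hF h => ⟨?_, ?_⟩
      · rw [hF.nat 10]; simp [f10]
      · simpa [f10] using h
    · intro i m₃ _ hF3 _ hI
      have g0 : m₃.nat 0 = n := by rw [hF3.nat 0]; simp [f0]
      have g2 : m₃.nat 2 = 1 := by rw [hF3.nat 2]; simpa using f2
      have g3 : m₃.nat 3 = 0 := by rw [hF3.nat 3]; simpa using f3
      refine Achieves.weaken (T := 6 * X + 1) ?_ (by rw [pow_one]; omega) fun _ _ h => h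
      refine (Achieves.mulNat hX (by rwa [g0]) g2).seq fun m₄ hF4 h12 => ?_
      refine ⟨1, _, .instr rfl, le_rfl, ?_⟩
      simp [h12, hF4.nat 3, g3, g0, hI, pow_succ, mul_comm]

/-- Compute `k! * k ^ k` into the real variable `11` and `(k / 2)! ^ 4 * (1 - p) ^ 2` into the real
variable `12`. -/
def computeConstants : Program :=
  .seq (.instr (.realOfNat 11 2))
    (.seq (forLoop 11 1 (block [.natAdd 12 11 2, .realOfNat 2 12, .realMul 11 11 2,
      .realOfNat 2 1, .realMul 11 11 2]))
    (.seq (.instr (.realOfNat 12 2))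
      (.seq (forLoop 11 10 (block [.natAdd 12 11 2, .realOfNat 2 12, .realMul 12 12 2]))
        (block [.realMul 12 12 12, .realMul 12 12 12, .realOfNat 2 2, .realSub 2 2 0,
          .realMul 12 12 2, .realMul 12 12 2]))))

theorem achieves_computeConstants {m : State} {X k h : ℕ} {p : ℝ} (hX : 1 ≤ X)
    (h1 : m.nat 1 = k) (hkX : k ≤ X) (h10 : m.nat 10 = h) (hhX : h ≤ X)
    (h2 : m.nat 2 = 1) (hp : m.real 0 = p) :
    Achieves computeConstants m (24 * X) fun m' =>
      m'.real 11 = (k.factorial : ℝ) * (k : ℝ) ^ k ∧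
        m'.real 12 = (h.factorial : ℝ) ^ 4 * (1 - p) ^ 2 := by
  refine Achieves.weaken (T := 1 + ((5 + 4) * X ^ (0 + 1) + (1 + ((3 + 4) * X ^ (0 + 1) + 6))))
    ?_ (by norm_num; omega) fun _ _ h => h
  refine Achieves.seq (R := fun m' => m'.real 11 = 1) ⟨1, _, .instr rfl, le_rfl, by simp [h2]⟩
    fun m₁ hF1 hr1 => ?_
  have e1 : m₁.nat 1 = k := by rw [hF1.nat 1, h1]
  have e2 : m₁.nat 2 = 1 := by rw [hF1.nat 2, h2]
  have hloop := Achieves.forLoop_poly (x := 11) (N := 1)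
    (body := block [.natAdd 12 11 2, .realOfNat 2 12, .realMul 11 11 2,
      .realOfNat 2 1, .realMul 11 11 2])
    (m := m₁) (c := 5) (e := 0) hX (by rwa [e1])
    (fun i m' => m'.real 11 = (i.factorial : ℝ) * (k : ℝ) ^ i) e2 (by simp [hr1]) ?_
  swap
  · intro i m' _ hF h11 hI
    have a1 : m'.nat 1 = k := by rw [hF.nat 1, e1]
    have a2 : m'.nat 2 = 1 := by rw [hF.nat 2, e2]
    refine (Achieves.block (by simp) rfl ?_).weaken (by simp) fun _ _ h => h
    simp [a1, a2, h11, hI, Nat.factorial_succ, pow_succ]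
    ring
  refine hloop.seq fun m₂ hF2 hr2 => ?_
  rw [e1] at hr2
  have f2 : m₂.nat 2 = 1 := by rw [hF2.nat 2, e2]
  refine Achieves.seq (R := fun m' => m'.real 12 = 1) ⟨1, _, .instr rfl, le_rfl, by simp [f2]⟩
    fun m₃ hF3 hr3 => ?_
  have g10 : m₃.nat 10 = h := by rw [hF3.nat 10, hF2.nat 10, hF1.nat 10, h10]
  have g2 : m₃.nat 2 = 1 := by rw [hF3.nat 2, f2]
  have hloop' := Achieves.forLoop_poly (x := 11) (N := 10)
    (body := block [.natAdd 12 11 2, .realOfNat 2 12, .realMul 12 12 2])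
    (m := m₃) (c := 3) (e := 0) hX (by rwa [g10])
    (fun i m' => m'.real 12 = (i.factorial : ℝ)) g2 (by simp [hr3]) ?_
  swap
  · intro i m' _ hF h11 hI
    have a2 : m'.nat 2 = 1 := by rw [hF.nat 2, g2]
    refine (Achieves.block (by simp) rfl ?_).weaken (by simp) fun _ _ h => h
    simp [a2, h11, hI, Nat.factorial_succ]
    ring
  refine hloop'.seq fun m₄ hF4 hr4 => ?_
  rw [g10] at hr4
  have i2 : m₄.nat 2 = 1 := by rw [hF4.nat 2, g2]
  have ip : m₄.real 0 = p := by rw [hF4.real 0, hF3.real 0, hF2.real 0, hF1.real 0, hp]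
  have i11 : m₄.real 11 = (k.factorial : ℝ) * (k : ℝ) ^ k := by
    rw [hF4.real 11, hF3.real 11, hr2]
  refine (Achieves.block (by simp) rfl ?_)
  simp [i2, ip, i11, hr4]
  ring

/-- Copy the candidate `L` in variable `15` to variable `14`, unless `L ≥ k` and all pivots of the
matrix `α * 1 - β * G` are positive, where `α` is `L ^ k` times the real variable `12`. -/
def testCandidate : Program :=
  .seq (block [.realAdd 10 12 21, .realOfNat 2 15])
    (.seq (forLoop 11 1 (.instr (.realMul 10 10 2)))
      (.seq testPivots
        (.ite (.natLt 15 1) (.instr (.natAdd 14 15 3))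
          (.ite (.natLt 16 2) (.instr (.natAdd 14 15 3)) skip))))

/-- A candidate `L ≥ k` is not refuted if the elimination on the matrix
`L ^ k * α - β * G` meets a pivot that is not positive. -/
def NotRefuted (k D : ℕ) (α β : ℝ) (G : ℕ → ℕ → ℝ) (L : ℕ) : Prop :=
  L < k ∨ ∃ j < D,
    eliminated (fun i l => (if i = l then α * (L : ℝ) ^ k else 0) - β * G i l) j j j ≤ 0

open Classical in
theorem achieves_testCandidate {m : State} {X D k : ℕ} (G : ℕ → ℕ → ℝ) (hX : 1 ≤ X)
    (h1 : m.nat 1 = k) (hkX : k ≤ X) (hD : m.nat 4 = D) (hDX : D ≤ X) (h2 : m.nat 2 = 1)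
    (h3 : m.nat 3 = 0) (h21 : m.real 21 = 0)
    (hG : ∀ i l, i < D → l < D → m.realArr 2 (D * l + i) = G i l) :
    Achieves testCandidate m (90 * X ^ 3) fun m' =>
      m'.nat 14 = if NotRefuted k D (m.real 12) (m.real 11) G (m.nat 15) then m.nat 15
        else m.nat 14 := by
  refine Achieves.weaken (T := 2 + ((1 + 4) * X ^ (0 + 1) + (78 * X ^ 3 + (1 + 1 + 1))))
    ?_ ?_ fun _ _ h => h
  swap
  · have h : X ≤ X ^ 3 := Nat.le_self_pow (by omega) X
    norm_num
    omega
  refine Achieves.seq (T := 2) (R := fun m' => m'.real 10 = m.real 12 ∧ m'.real 2 = m.nat 15)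
    (Achieves.block (by simp) rfl ?_) fun m₁ hF1 ⟨hr10, hr2⟩ => ?_
  · simp [h21]
  have e1 : m₁.nat 1 = k := by rw [hF1.nat 1, h1]
  have hloop := Achieves.forLoop_poly (x := 11) (N := 1)
    (body := .instr (.realMul 10 10 2))
    (m := m₁) (c := 1) (e := 0) hX (by rwa [e1])
    (fun i m' => m'.real 10 = m.real 12 * (m.nat 15 : ℝ) ^ i) (by rw [hF1.nat 2, h2])
    (by simp [hr10]) ?_
  swap
  · intro i m' _ hF h11 hI
    refine ⟨1, _, .instr rfl, by simp, ?_⟩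
    simp [hF.real 2, hr2, hI, pow_succ]
    ring
  refine hloop.seq fun m₂ hF2 hr => ?_
  rw [e1] at hr
  refine (achieves_testPivots G hX (by rw [hF2.nat 4, hF1.nat 4, hD]) hDX
    (by rw [hF2.nat 2, hF1.nat 2, h2]) (by rw [hF2.real 21, hF1.real 21, h21])
    (by rw [hF2.realArr 2, hF1.realArr 2]; exact hG)).seq fun m₃ hF3 h16 => ?_
  rw [hr, hF2.real 11, hF1.real 11] at h16
  have g1 : m₃.nat 1 = k := by rw [hF3.nat 1, hF2.nat 1, e1]
  have g2 : m₃.nat 2 = 1 := by rw [hF3.nat 2, hF2.nat 2, hF1.nat 2, h2]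
  have g3 : m₃.nat 3 = 0 := by rw [hF3.nat 3, hF2.nat 3, hF1.nat 3, h3]
  have g14 : m₃.nat 14 = m.nat 14 := by rw [hF3.nat 14, hF2.nat 14, hF1.nat 14]
  have g15 : m₃.nat 15 = m.nat 15 := by rw [hF3.nat 15, hF2.nat 15, hF1.nat 15]
  refine Achieves.ite (fun hb => ?_) fun hb => ?_
  · simp only [Test.Holds, g15, g1] at hb
    refine Achieves.weaken (T := 1) ⟨1, _, .instr rfl, le_rfl, ?_⟩ (by simp) fun _ _ h => h
    have hg : NotRefuted k D (m.real 12) (m.real 11) G (m.nat 15) := Or.inl hb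
    simp [g15, g3, hg]
  · simp only [Test.Holds, g15, g1] at hb
    refine Achieves.ite (fun hb' => ?_) fun hb' => ?_
    · simp only [Test.Holds, g2] at hb'
      refine ⟨1, _, .instr rfl, le_rfl, ?_⟩
      have hg : NotRefuted k D (m.real 12) (m.real 11) G (m.nat 15) := Or.inr (h16.1 hb')
      simp [g15, g3, hg]
    · simp only [Test.Holds, g2] at hb'
      refine Achieves.skip ?_
      rw [if_neg fun h => h.elim hb fun h => hb' (h16.2 h)]
      simp [g14]

/-- Find the largest candidate `L ≤ n` that is not refuted. -/
def searchCandidates : Program :=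
  .seq (block [.natAdd 13 0 2, .natConst 14 0]) (forLoop 15 13 testCandidate)

theorem achieves_searchCandidates {m : State} {X D k n : ℕ} (G : ℕ → ℕ → ℝ) (hX : 1 ≤ X)
    (h0 : m.nat 0 = n) (hnX : n + 1 ≤ X)
    (h1 : m.nat 1 = k) (hk0 : 0 < k) (hkX : k ≤ X) (hD : m.nat 4 = D) (hDX : D ≤ X)
    (h2 : m.nat 2 = 1) (h3 : m.nat 3 = 0) (h21 : m.real 21 = 0)
    (hG : ∀ i l, i < D → l < D → m.realArr 2 (D * l + i) = G i l) :
    Achieves searchCandidates m (96 * X ^ 4) fun m' =>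
      IsGreatest {L | L ≤ n ∧ NotRefuted k D (m.real 12) (m.real 11) G L} (m'.nat 14) := by
  classical
  refine Achieves.weaken (T := 2 + (90 + 4) * X ^ (3 + 1)) ?_ ?_ fun _ _ h => h
  swap
  · have h : 1 ≤ X ^ 4 := Nat.one_le_pow _ _ hX
    norm_num
    omega
  refine Achieves.seq (T := 2) (R := fun m' => m'.nat 13 = n + 1 ∧ m'.nat 14 = 0)
    (Achieves.block (by simp) rfl ?_) fun m₁ hF1 ⟨h13, h14⟩ => ?_
  · simp [h0, h2]
  have hloop := Achieves.forLoop_poly (x := 15) (N := 13) (body := testCandidate)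
    (m := m₁) (c := 90) (e := 3) hX (by rwa [h13])
    (fun i m' => (m'.nat 14 ≤ n ∧ NotRefuted k D (m.real 12) (m.real 11) G (m'.nat 14)) ∧
      ∀ L < i, NotRefuted k D (m.real 12) (m.real 11) G L → L ≤ m'.nat 14)
    (by rw [hF1.nat 2, h2]) ?_ ?_
  · refine hloop.weaken le_rfl fun m' _ ⟨h, h'⟩ => ⟨h, fun L hL => ?_⟩
    rw [h13] at h'
    exact h' L (Nat.lt_succ_of_le hL.1) hL.2
  · simp [h14, NotRefuted, hk0]
  · intro i m₂ hi hF2 h15 ⟨⟨hI1, hI2⟩, hI3⟩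
    rw [h13] at hi
    have e12 : m₂.real 12 = m.real 12 := by rw [hF2.real 12, hF1.real 12]
    have e11 : m₂.real 11 = m.real 11 := by rw [hF2.real 11, hF1.real 11]
    refine (achieves_testCandidate (m := m₂) G hX (by rw [hF2.nat 1, hF1.nat 1, h1]) hkX
      (by rw [hF2.nat 4, hF1.nat 4, hD]) hDX (by rw [hF2.nat 2, hF1.nat 2, h2])
      (by rw [hF2.nat 3, hF1.nat 3, h3]) (by rw [hF2.real 21, hF1.real 21, h21])
      (by rw [hF2.realArr 2, hF1.realArr 2]; exact hG)).weaken le_rfl fun m₃ _ h => ?_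
    rw [e12, e11, h15] at h
    have e14 : (m₃.setNat 15 (i + 1)).nat 14 = m₃.nat 14 := by simp
    rw [e14, h]
    split_ifs with hg
    · exact ⟨⟨Nat.lt_succ_iff.1 hi, hg⟩, fun L hL _ => Nat.lt_succ_iff.1 hL⟩
    · refine ⟨⟨hI1, hI2⟩, fun L hL hgL => ?_⟩
      rcases Nat.lt_succ_iff_lt_or_eq.1 hL with hL | rfl
      · exact hI3 L hL hgL
      · exact absurd hgL hg

/-- The computation in the case `k ≤ n` and `p < 1`. -/
def mainProgram : Program :=
  .seq computeSizes (.seq fillWeights (.seq fillGram (.seq computeConstants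
    (.seq searchCandidates (.instr (.natAdd 0 14 3))))))

/-- The whole program. If `n < k` or `p = 1`, then the output is `n`, which already stands in
variable `0`. -/
def program : Program :=
  .seq (block [.natConst 2 1, .realOfNat 1 2])
    (.ite (.natLt 0 1) skip (.ite (.realLt 0 1) mainProgram skip))

/-- The Gram matrix of the columns of the matrix of tuple weights. -/
noncomputable def tupleGram (n k : ℕ) (bit : ℕ → ℕ) (p : ℝ) (i l : ℕ) : ℝ :=
  ∑ w ∈ Finset.range (n ^ (k / 2)), tupleWeight n k bit p (n ^ (k / 2) * i + w) *
    tupleWeight n k bit p (n ^ (k / 2) * l + w)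

theorem achieves_mainProgram {m : State} {n k : ℕ} {p : ℝ} (h0 : m.nat 0 = n) (h1 : m.nat 1 = k)
    (hk : Even k) (hk2 : 2 ≤ k) (hkn : k ≤ n) (h2 : m.nat 2 = 1) (h3 : m.nat 3 = 0)
    (hp : m.real 0 = p) (h21 : m.real 21 = 0) :
    Achieves mainProgram m (300 * (n ^ k) ^ 4) fun m' =>
      IsGreatest {L | L ≤ n ∧ NotRefuted k (n ^ (k / 2)) (((k / 2).factorial : ℝ) ^ 4 * (1 - p) ^ 2)
        ((k.factorial : ℝ) * (k : ℝ) ^ k) (tupleGram n k (m.natArr 0) p) L} (m'.nat 0) := by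
  set X := n ^ k with hXdef
  set D := n ^ (k / 2) with hDdef
  have hn2 : 2 ≤ n := hk2.trans hkn
  have hnX : n + 1 ≤ X := by
    calc n + 1 ≤ n * n := by nlinarith
      _ = n ^ 2 := (sq n).symm
      _ ≤ n ^ k := Nat.pow_le_pow_right (by omega) hk2
  have hX : 1 ≤ X := by omega
  have hDD : D * D = X := by
    rw [hDdef, ← pow_add, hXdef]
    congr 1
    obtain ⟨r, hr⟩ := hk
    omega
  have hDX : D ≤ X := (Nat.le_mul_self D).trans hDD.le
  refine Achieves.weaken (T := 20 * X ^ 2 + (50 * X ^ 4 + (33 * X ^ 3 + (24 * X +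
    (96 * X ^ 4 + 1))))) ?_ ?_ fun _ _ h => h
  swap
  · have a1 : X ≤ X ^ 4 := Nat.le_self_pow (by omega) X
    have a2 : X ^ 2 ≤ X ^ 4 := Nat.pow_le_pow_right hX (by omega)
    have a3 : X ^ 3 ≤ X ^ 4 := Nat.pow_le_pow_right hX (by omega)
    omega
  refine (achieves_computeSizes hX (by rw [h0]; omega) (by rw [h1]; omega) (by rwa [h1]) h2
    h3).seq fun m₁ hF1 ⟨h10, h4⟩ => ?_
  rw [h1] at h10
  rw [h0, h1] at h4
  have a0 : m₁.nat 0 = n := by rw [hF1.nat 0, h0]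
  have a1 : m₁.nat 1 = k := by rw [hF1.nat 1, h1]
  have a2 : m₁.nat 2 = 1 := by rw [hF1.nat 2, h2]
  have a3 : m₁.nat 3 = 0 := by rw [hF1.nat 3, h3]
  refine (achieves_fillWeights hX h4 hDD.le (by rw [a1]; omega) (by rw [a0]; omega) a2 a3).seq
    fun m₂ hF2 hW => ?_
  rw [a0, a1, hF1.natArr 0, hF1.real 0, hp] at hW
  have b4 : m₂.nat 4 = D := by rw [hF2.nat 4, h4]
  have b2 : m₂.nat 2 = 1 := by rw [hF2.nat 2, a2]
  refine (achieves_fillGram hX b4 hDX b2).seq fun m₃ hF3 hG => ?_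
  have c0 : m₃.nat 0 = n := by rw [hF3.nat 0, hF2.nat 0, a0]
  have c1 : m₃.nat 1 = k := by rw [hF3.nat 1, hF2.nat 1, a1]
  have c2 : m₃.nat 2 = 1 := by rw [hF3.nat 2, b2]
  have c3 : m₃.nat 3 = 0 := by rw [hF3.nat 3, hF2.nat 3, a3]
  have c4 : m₃.nat 4 = D := by rw [hF3.nat 4, b4]
  have c10 : m₃.nat 10 = k / 2 := by rw [hF3.nat 10, hF2.nat 10, h10]
  have cp : m₃.real 0 = p := by rw [hF3.real 0, hF2.real 0, hF1.real 0, hp]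
  have c21 : m₃.real 21 = 0 := by rw [hF3.real 21, hF2.real 21, hF1.real 21, h21]
  refine (achieves_computeConstants hX c1 (by omega) c10 (by omega) c2 cp).seq
    fun m₄ hF4 ⟨h11, h12⟩ => ?_
  have hG' : ∀ i l, i < D → l < D →
      m₄.realArr 2 (D * l + i) = tupleGram n k (m.natArr 0) p i l := by
    intro i l hi hl
    rw [hF4.realArr 2, hG i l hi hl, tupleGram]
    refine Finset.sum_congr rfl fun w hw => ?_
    rw [hW w i (Finset.mem_range.1 hw) hi, hW w l (Finset.mem_range.1 hw) hl]
  refine (achieves_searchCandidates _ hX (by rw [hF4.nat 0, c0]) hnX (by rw [hF4.nat 1, c1])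
    (by omega) (by omega) (by rw [hF4.nat 4, c4]) hDX (by rw [hF4.nat 2, c2])
    (by rw [hF4.nat 3, c3]) (by rw [hF4.real 21, c21]) hG').seq fun m₅ hF5 hgr => ?_
  rw [h11, h12] at hgr
  refine ⟨1, _, .instr rfl, le_rfl, ?_⟩
  simpa [hF5.nat 3, hF4.nat 3, c3] using hgr


/-! ### Positive pivots and positive definite matrices -/

/-- The quadratic form of the part of `M` with indices in `[j, D)` is positive definite. -/
def PosDefFrom (D j : ℕ) (M : ℕ → ℕ → ℝ) : Prop :=
  ∀ x : ℕ → ℝ, (∃ i, j ≤ i ∧ i < D ∧ x i ≠ 0) →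
    0 < ∑ i ∈ Finset.Ico j D, ∑ l ∈ Finset.Ico j D, M i l * x i * x l

/-- Completing the square in the variable with index `j`. -/
theorem quadraticForm_eliminate {D j : ℕ} (hj : j < D) {M : ℕ → ℕ → ℝ}
    (hM : ∀ i l, M i l = M l i) (x : ℕ → ℝ) :
    M j j * ∑ i ∈ Finset.Ico j D, ∑ l ∈ Finset.Ico j D, M i l * x i * x l =
      (M j j * x j + ∑ l ∈ Finset.Ico (j + 1) D, M j l * x l) ^ 2 +
      ∑ i ∈ Finset.Ico (j + 1) D, ∑ l ∈ Finset.Ico (j + 1) D, eliminate M j i l * x i * x l := by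
  have h1 : ∑ i ∈ Finset.Ico (j + 1) D, ∑ l ∈ Finset.Ico (j + 1) D,
      eliminate M j i l * x i * x l =
      M j j * ∑ i ∈ Finset.Ico (j + 1) D, ∑ l ∈ Finset.Ico (j + 1) D, M i l * x i * x l -
        (∑ l ∈ Finset.Ico (j + 1) D, M j l * x l) ^ 2 := by
    rw [sq, Finset.sum_mul_sum, Finset.mul_sum, ← Finset.sum_sub_distrib]
    refine Finset.sum_congr rfl fun i _ => ?_
    rw [Finset.mul_sum, ← Finset.sum_sub_distrib]
    refine Finset.sum_congr rfl fun l _ => ?_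
    rw [eliminate, hM i j]
    ring
  have h2 : ∀ i, ∑ l ∈ Finset.Ico j D, M i l * x i * x l =
      M i j * x i * x j + ∑ l ∈ Finset.Ico (j + 1) D, M i l * x i * x l := fun i => by
    rw [Finset.sum_eq_sum_Ico_succ_bot hj]
  have h3 : ∑ i ∈ Finset.Ico (j + 1) D, M i j * x i * x j =
      (∑ l ∈ Finset.Ico (j + 1) D, M j l * x l) * x j := by
    rw [Finset.sum_mul]
    exact Finset.sum_congr rfl fun i _ => by rw [hM i j]
  have h4 : ∑ l ∈ Finset.Ico (j + 1) D, M j l * x j * x l =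
      (∑ l ∈ Finset.Ico (j + 1) D, M j l * x l) * x j := by
    rw [Finset.sum_mul]
    exact Finset.sum_congr rfl fun i _ => by ring
  rw [h1, Finset.sum_eq_sum_Ico_succ_bot hj]
  simp only [h2]
  rw [Finset.sum_add_distrib, h3, h4]
  ring

theorem posDefFrom_iff {D j : ℕ} (hj : j < D) {M : ℕ → ℕ → ℝ} (hM : ∀ i l, M i l = M l i) :
    PosDefFrom D j M ↔ 0 < M j j ∧ PosDefFrom D (j + 1) (eliminate M j) := by
  have hcongr : ∀ (x y : ℕ → ℝ) (N : ℕ → ℕ → ℝ) (s : Finset ℕ), (∀ i ∈ s, x i = y i) →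
      ∑ i ∈ s, ∑ l ∈ s, N i l * x i * x l = ∑ i ∈ s, ∑ l ∈ s, N i l * y i * y l := by
    intro x y N s h
    exact Finset.sum_congr rfl fun i hi => Finset.sum_congr rfl fun l hl => by rw [h i hi, h l hl]
  constructor
  · intro h
    have hd : 0 < M j j := by
      have := h (Pi.single j 1) ⟨j, le_rfl, hj, by simp⟩
      rw [Finset.sum_eq_single j, Finset.sum_eq_single j] at this
      · simpa using this
      · intro l _ hl; simp [hl]
      · intro hn; exact absurd (Finset.mem_Ico.2 ⟨le_rfl, hj⟩) hn
      · intro i _ hi; simp [hi]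
      · intro hn; exact absurd (Finset.mem_Ico.2 ⟨le_rfl, hj⟩) hn
    refine ⟨hd, fun x ⟨i, hi, hiD, hxi⟩ => ?_⟩
    -- choose the coordinate with index `j` so that the square vanishes
    set y : ℕ → ℝ := Function.update x j
      (-(∑ l ∈ Finset.Ico (j + 1) D, M j l * x l) / M j j) with hy
    have hxy : ∀ i ∈ Finset.Ico (j + 1) D, y i = x i := fun i hi => by
      have := (Finset.mem_Ico.1 hi).1
      rw [hy, Function.update_of_ne (by omega)]
    have hpos := h y ⟨i, by omega, hiD, by rwa [hxy i (Finset.mem_Ico.2 ⟨hi, hiD⟩)]⟩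
    have hq := quadraticForm_eliminate hj hM y
    have hlin : ∑ l ∈ Finset.Ico (j + 1) D, M j l * y l =
        ∑ l ∈ Finset.Ico (j + 1) D, M j l * x l :=
      Finset.sum_congr rfl fun l hl => by rw [hxy l hl]
    have hzero : M j j * y j + ∑ l ∈ Finset.Ico (j + 1) D, M j l * y l = 0 := by
      rw [hlin, hy, Function.update_self]
      field_simp
      ring
    rw [hzero, hcongr y x _ _ hxy] at hq
    have := mul_pos hd hpos
    rw [hq] at this
    simpa using this
  · rintro ⟨hd, h⟩ x ⟨i, hi, hiD, hxi⟩
    refine pos_of_mul_pos_right (a := M j j) ?_ hd.le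
    rw [quadraticForm_eliminate hj hM]
    by_cases hex : ∃ i, j + 1 ≤ i ∧ i < D ∧ x i ≠ 0
    · have := h x hex
      positivity
    · push Not at hex
      have hx0 : ∀ i ∈ Finset.Ico (j + 1) D, x i = 0 := fun i hi =>
        hex i (Finset.mem_Ico.1 hi).1 (Finset.mem_Ico.1 hi).2
      have hij : i = j := by
        by_contra hne
        exact hxi (hex i (by omega) hiD)
      rw [hij] at hxi
      rw [hcongr x 0 _ _ hx0, Finset.sum_eq_zero fun l hl => by rw [hx0 l hl, mul_zero]]
      simp only [Pi.zero_apply, mul_zero, Finset.sum_const_zero, add_zero]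
      positivity

theorem eliminated_symm {M : ℕ → ℕ → ℝ} (hM : ∀ i l, M i l = M l i) (j i l : ℕ) :
    eliminated M j i l = eliminated M j l i := by
  induction j generalizing i l with
  | zero => exact hM i l
  | succ j ih =>
    simp only [eliminated, eliminate]
    rw [ih i l, ih i j, ih j l]
    ring

/-- A symmetric matrix is positive definite if and only if all pivots are positive. -/
theorem posDefFrom_zero_iff (D : ℕ) {M : ℕ → ℕ → ℝ} (hM : ∀ i l, M i l = M l i) :
    PosDefFrom D 0 M ↔ ∀ j < D, 0 < eliminated M j j j := by
  have key : ∀ j ≤ D, PosDefFrom D 0 M ↔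
      (∀ i < j, 0 < eliminated M i i i) ∧ PosDefFrom D j (eliminated M j) := by
    intro j
    induction j with
    | zero => simp [eliminated]
    | succ j ih =>
      intro hj
      rw [ih (by omega), posDefFrom_iff (by omega) (eliminated_symm hM j), ← and_assoc]
      refine and_congr_left' ?_
      simp only [Nat.lt_succ_iff_lt_or_eq, or_imp, forall_and, forall_eq]
  rw [key D le_rfl, and_iff_left]
  rintro x ⟨i, hi, hiD, -⟩
  omega

theorem quadraticForm_gram (D : ℕ) (α β : ℝ) (W : ℕ → ℕ → ℝ) (x : ℕ → ℝ) :
    ∑ i ∈ Finset.range D, ∑ l ∈ Finset.range D,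
      ((if i = l then α else 0) - β * ∑ w ∈ Finset.range D, W w i * W w l) * x i * x l =
    α * ∑ i ∈ Finset.range D, x i ^ 2 -
      β * ∑ w ∈ Finset.range D, (∑ i ∈ Finset.range D, W w i * x i) ^ 2 := by
  have h1 : ∑ w ∈ Finset.range D, (∑ i ∈ Finset.range D, W w i * x i) ^ 2 =
      ∑ i ∈ Finset.range D, ∑ l ∈ Finset.range D,
        (∑ w ∈ Finset.range D, W w i * W w l) * x i * x l := by
    have h2 : ∀ w, (∑ i ∈ Finset.range D, W w i * x i) ^ 2 = ∑ i ∈ Finset.range D,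
        ∑ l ∈ Finset.range D, W w i * W w l * x i * x l := fun w => by
      rw [sq, Finset.sum_mul_sum]
      exact Finset.sum_congr rfl fun i _ => Finset.sum_congr rfl fun l _ => by ring
    simp only [h2, Finset.sum_mul]
    rw [Finset.sum_comm]
    exact Finset.sum_congr rfl fun i _ => Finset.sum_comm
  rw [h1, Finset.mul_sum, Finset.mul_sum, ← Finset.sum_sub_distrib]
  refine Finset.sum_congr rfl fun i hi => ?_
  simp only [sub_mul, Finset.sum_sub_distrib, ite_mul, zero_mul, Finset.sum_ite_eq, hi, if_true,
    mul_assoc, ← Finset.mul_sum, sq]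

/-! ### Blowing up a matrix along a scaled isometry -/

section BlowUp

variable {ι κ : Type*} [Fintype ι] [DecidableEq ι] [Fintype κ]

open Matrix

theorem sum_sq_pos {τ : Type*} [Fintype τ] {x : τ → ℝ} (hx : x ≠ 0) : 0 < ∑ f, x f ^ 2 := by
  obtain ⟨i, hi⟩ := Function.ne_iff.1 hx
  exact Finset.sum_pos' (fun _ _ => sq_nonneg _) ⟨i, Finset.mem_univ i, sq_pos_of_ne_zero hi⟩

theorem sum_mulVec_sq_of_transpose_mul_self {P : Matrix κ ι ℝ} {c : ℝ} (hP : Pᵀ * P = c • 1)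
    (z : ι → ℝ) : ∑ f, (P *ᵥ z) f ^ 2 = c * ∑ i, z i ^ 2 := by
  have h : (P *ᵥ z) ⬝ᵥ (P *ᵥ z) = c * (z ⬝ᵥ z) := by
    rw [dotProduct_mulVec, vecMul_mulVec, ← dotProduct_mulVec, hP]
    simp [smul_mulVec, dotProduct_smul]
  simpa only [dotProduct, ← sq] using h

theorem sum_transpose_mulVec_sq_le {P : Matrix κ ι ℝ} {c : ℝ} (hc : 0 ≤ c) (hP : Pᵀ * P = c • 1)
    (x : κ → ℝ) : ∑ i, (Pᵀ *ᵥ x) i ^ 2 ≤ c * ∑ f, x f ^ 2 := by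
  set u := Pᵀ *ᵥ x with hu
  have h1 : ∑ i, u i ^ 2 = ∑ f, x f * (P *ᵥ u) f := by
    have : u ⬝ᵥ u = x ⬝ᵥ (P *ᵥ u) := by
      rw [dotProduct_mulVec x P u, ← mulVec_transpose]
    simpa only [dotProduct, ← sq] using this
  have h2 := Finset.sum_mul_sq_le_sq_mul_sq Finset.univ x (P *ᵥ u)
  rw [sum_mulVec_sq_of_transpose_mul_self hP, ← h1] at h2
  have h3 : 0 ≤ ∑ i, u i ^ 2 := Finset.sum_nonneg fun _ _ => sq_nonneg _
  have h4 : 0 ≤ ∑ f, x f ^ 2 := Finset.sum_nonneg fun _ _ => sq_nonneg _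
  rcases h3.eq_or_lt with h | h
  · rw [← h]; positivity
  · refine le_of_mul_le_mul_right ?_ h
    linarith

/-- If the columns of `P` are orthogonal of square length `c`, then the norm of `P * A * Pᵀ` is
`c` times the norm of `A`. -/
theorem blowUp_posDef_iff [Nonempty ι] {P : Matrix κ ι ℝ} {c : ℝ} (hc : 0 < c)
    (hP : Pᵀ * P = c • 1) (A : Matrix ι ι ℝ) {α β : ℝ} (hβ : 0 < β) :
    (∀ x : κ → ℝ, x ≠ 0 → 0 < α * ∑ f, x f ^ 2 - β * ∑ f, ((P * A * Pᵀ) *ᵥ x) f ^ 2) ↔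
      β * c ^ 2 * ‖Matrix.toEuclideanCLM (𝕜 := ℝ) A‖ ^ 2 < α := by
  have hB : ∀ x : κ → ℝ, ∑ f, ((P * A * Pᵀ) *ᵥ x) f ^ 2 = c * ∑ i, (A *ᵥ (Pᵀ *ᵥ x)) i ^ 2 := by
    intro x
    rw [← sum_mulVec_sq_of_transpose_mul_self hP, mulVec_mulVec, mulVec_mulVec, Matrix.mul_assoc]
  constructor
  · intro h
    obtain ⟨y, hy, hle⟩ := exists_norm_sq_mul_le_sum_mulVec_sq A
    have hPy : ∑ f, (P *ᵥ y) f ^ 2 = c * ∑ i, y i ^ 2 := sum_mulVec_sq_of_transpose_mul_self hP y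
    have hy2 := sum_sq_pos hy
    have hx0 : P *ᵥ y ≠ 0 := by
      intro h0
      rw [h0] at hPy
      have : 0 < c * ∑ i, y i ^ 2 := by positivity
      simp [← hPy] at this
    have h1 := h _ hx0
    rw [hB, hPy, mulVec_mulVec y Pᵀ P, hP, smul_mulVec, one_mulVec, mulVec_smul] at h1
    simp only [Pi.smul_apply, smul_eq_mul, mul_pow, ← Finset.mul_sum] at h1
    have h2 : β * (c * (c ^ 2 * (‖Matrix.toEuclideanCLM (𝕜 := ℝ) A‖ ^ 2 * ∑ i, y i ^ 2))) ≤
        β * (c * (c ^ 2 * ∑ i, (A *ᵥ y) i ^ 2)) := by gcongr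
    refine lt_of_mul_lt_mul_right (a := c * ∑ i, y i ^ 2) ?_ (by positivity)
    linarith
  · intro h x hx
    have hx2 := sum_sq_pos hx
    have h1 := sum_mulVec_sq_le A (Pᵀ *ᵥ x)
    have h2 := sum_transpose_mulVec_sq_le hc.le hP x
    rw [hB, sub_pos]
    calc β * (c * ∑ i, (A *ᵥ (Pᵀ *ᵥ x)) i ^ 2)
        ≤ β * (c * (‖Matrix.toEuclideanCLM (𝕜 := ℝ) A‖ ^ 2 * (c * ∑ f, x f ^ 2))) := by
          gcongr
          exact h1.trans (by gcongr)
      _ = (β * c ^ 2 * ‖Matrix.toEuclideanCLM (𝕜 := ℝ) A‖ ^ 2) * ∑ f, x f ^ 2 := by ring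
      _ < α * ∑ f, x f ^ 2 := by gcongr

end BlowUp

/-! ### The matrix of tuple weights as a blow-up of the spectral matrix -/

section Tuples

variable {k n : ℕ}

theorem finFunctionFinEquiv_digit {m : ℕ} (v : Fin m → Fin n) (a : Fin m) :
    (finFunctionFinEquiv v : ℕ) / n ^ (a : ℕ) % n = v a := by
  conv_rhs => rw [← finFunctionFinEquiv.symm_apply_apply v]
  rw [finFunctionFinEquiv_symm_apply_val]

theorem edgeBit_finFunctionFinEquiv (H : UHypergraph k n) (v : Fin k → Fin n)
    (hv : (Finset.univ.image v).card = k) [Decidable ((⟨_, hv⟩ : KSubset n k) ∈ H)] :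
    edgeBit H (finFunctionFinEquiv v : ℕ) =
      if (⟨Finset.univ.image v, hv⟩ : KSubset n k) ∈ H then 1 else 0 := by
  classical
  unfold edgeBit
  refine if_congr ⟨?_, ?_⟩ rfl rfl
  · rintro ⟨v', hv', C, hC, hCv⟩
    rw [← finFunctionFinEquiv_apply, Fin.val_inj, finFunctionFinEquiv.apply_eq_iff_eq] at hv'
    subst hv'
    convert hC
    exact hCv.symm
  · intro h
    exact ⟨v, finFunctionFinEquiv_apply v, _, h, rfl⟩

theorem tupleWeight_of_card_eq (H : UHypergraph k n) (p : ℝ) (v : Fin k → Fin n)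
    (hv : (Finset.univ.image v).card = k) :
    tupleWeight n k (edgeBit H) p (finFunctionFinEquiv v : ℕ) = edgeWeight H p ⟨_, hv⟩ := by
  classical
  have hinj : Function.Injective v := by
    rw [← Set.injOn_univ, ← Finset.coe_univ, ← Finset.card_image_iff, hv]; simp
  rw [tupleWeight, if_neg, edgeBit_finFunctionFinEquiv H v hv, edgeWeight]
  · split_ifs <;> simp
  · rintro ⟨b, hb, a, hab, h⟩
    have h1 := finFunctionFinEquiv_digit v ⟨a, hab.trans hb⟩
    have h2 := finFunctionFinEquiv_digit v ⟨b, hb⟩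
    simp only at h1 h2
    rw [h1, h2] at h
    have := hinj (Fin.ext h)
    simp only [Fin.mk.injEq] at this
    omega

theorem tupleWeight_of_card_ne (H : UHypergraph k n) (p : ℝ) (v : Fin k → Fin n)
    (hv : (Finset.univ.image v).card ≠ k) :
    tupleWeight n k (edgeBit H) p (finFunctionFinEquiv v : ℕ) = 0 := by
  classical
  have hinj : ¬ Function.Injective v := fun h => hv (by
    rw [Finset.card_image_of_injective _ h]; simp)
  rw [tupleWeight, if_pos]
  simp only [Function.Injective, not_forall] at hinj
  obtain ⟨a, b, h, hne⟩ := hinj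
  rcases lt_or_gt_of_ne hne with hlt | hlt
  · exact ⟨b, b.2, a, hlt, by rw [finFunctionFinEquiv_digit, finFunctionFinEquiv_digit, h]⟩
  · exact ⟨a, a.2, b, hlt, by rw [finFunctionFinEquiv_digit, finFunctionFinEquiv_digit, h]⟩

theorem finFunctionFinEquiv_append {h : ℕ} (f g : Fin h → Fin n) :
    (finFunctionFinEquiv (Fin.append f g) : ℕ) =
      n ^ h * (finFunctionFinEquiv g : ℕ) + finFunctionFinEquiv f := by
  simp only [finFunctionFinEquiv_apply, Fin.sum_univ_add, Fin.append_left, Fin.append_right,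
    Fin.val_castAdd, Fin.val_natAdd, pow_add, Finset.mul_sum]
  rw [add_comm]
  congr 1
  exact Finset.sum_congr rfl fun i _ => by ring

theorem image_append {h : ℕ} (f g : Fin h → Fin n) :
    Finset.univ.image (Fin.append f g) = Finset.univ.image f ∪ Finset.univ.image g := by
  ext x
  simp only [Finset.mem_image, Finset.mem_univ, true_and, Finset.mem_union]
  constructor
  · rintro ⟨a, rfl⟩
    refine Fin.addCases (fun i => ?_) (fun i => ?_) a
    · exact Or.inl ⟨i, by simp⟩
    · exact Or.inr ⟨i, (Fin.append_right f g i).symm⟩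
  · rintro (⟨a, rfl⟩ | ⟨a, rfl⟩)
    · exact ⟨Fin.castAdd h a, by simp⟩
    · exact ⟨Fin.natAdd h a, Fin.append_right f g a⟩

open Classical in
/-- The incidence matrix between `m`-tuples and the `m`-sets of their entries. -/
noncomputable def tupleIncidence (n m : ℕ) : Matrix (Fin m → Fin n) (KSubset n m) ℝ :=
  Matrix.of fun f S => if Finset.univ.image f = S.1 then 1 else 0

/-- There are `m!` tuples enumerating a given `m`-set. -/
theorem card_filter_image_eq {m : ℕ} (S : KSubset n m) [DecidableEq (Finset (Fin n))] :
    (Finset.univ.filter fun f : Fin m → Fin n => Finset.univ.image f = S.1).card =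
      m.factorial := by
  have hcard : Fintype.card (Fin m ≃ S.1) = m.factorial := by
    rw [Fintype.card_equiv (S.1.equivFinOfCardEq S.2).symm, Fintype.card_fin]
  rw [← hcard, ← Finset.card_univ]
  symm
  refine Finset.card_bij (fun e _ i => (e i : Fin n)) ?_ ?_ ?_
  · intro e _
    simp only [Finset.mem_filter, Finset.mem_univ, true_and]
    ext x
    simp only [Finset.mem_image, Finset.mem_univ, true_and]
    constructor
    · rintro ⟨i, rfl⟩; exact (e i).2
    · intro hx; exact ⟨e.symm ⟨x, hx⟩, by simp⟩
  · intro e _ e' _ h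
    ext i
    exact congrArg Fin.val (congrFun h i)
  · intro f hf
    have hf' : Finset.univ.image f = S.1 := (Finset.mem_filter.1 hf).2
    have hmem : ∀ i, f i ∈ S.1 := fun i => hf' ▸ Finset.mem_image_of_mem f (Finset.mem_univ i)
    have hinj : Function.Injective f := by
      rw [← Set.injOn_univ, ← Finset.coe_univ, ← Finset.card_image_iff, hf', S.2]; simp
    have hb : Function.Bijective fun i => (⟨f i, hmem i⟩ : S.1) :=
      (Fintype.bijective_iff_injective_and_card _).2
        ⟨fun i j h => hinj (congrArg Subtype.val h), by simp [S.2]⟩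
    exact ⟨Equiv.ofBijective _ hb, Finset.mem_univ _, rfl⟩

theorem tupleIncidence_transpose_mul_self (n m : ℕ) :
    (tupleIncidence n m).transpose * tupleIncidence n m = (m.factorial : ℝ) • 1 := by
  classical
  ext S T
  simp only [Matrix.mul_apply, Matrix.transpose_apply, tupleIncidence, Matrix.of_apply,
    Matrix.smul_apply, Matrix.one_apply, smul_eq_mul, mul_ite, mul_one, mul_zero]
  by_cases hST : S = T
  · subst hST
    rw [if_pos rfl, ← card_filter_image_eq S, Finset.card_filter]
    push_cast
    exact Finset.sum_congr rfl fun f _ => by split_ifs <;> rfl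
  · rw [if_neg hST]
    refine Finset.sum_eq_zero fun f _ => ?_
    split_ifs with h1 h2
    · exact absurd (Subtype.ext (h2.symm.trans h1)) hST
    · rfl
    · rfl

theorem tupleWeight_eq_mul (hk : Even k) (H : UHypergraph k n) (p : ℝ)
    (f g : Fin (k / 2) → Fin n) :
    tupleWeight n k (edgeBit H) p
      (n ^ (k / 2) * (finFunctionFinEquiv g : ℕ) + finFunctionFinEquiv f) =
    (tupleIncidence n (k / 2) * spectralMatrix H p * (tupleIncidence n (k / 2)).transpose) f g := by
  classical
  have hk2 : k / 2 + k / 2 = k := by obtain ⟨r, hr⟩ := hk; omega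
  -- the concatenation of `f` and `g`
  set v : Fin k → Fin n := Fin.append f g ∘ Fin.cast hk2.symm with hv
  have hcast : ∀ (a b : ℕ) (e : a = b) (u : Fin a → Fin n),
      (finFunctionFinEquiv (u ∘ Fin.cast e.symm) : ℕ) = finFunctionFinEquiv u ∧
        Finset.univ.image (u ∘ Fin.cast e.symm) = Finset.univ.image u := by
    rintro a _ rfl u
    exact ⟨rfl, rfl⟩
  have henc := (hcast _ _ hk2 (Fin.append f g)).1
  have himg := (hcast _ _ hk2 (Fin.append f g)).2
  rw [image_append] at himg
  rw [← finFunctionFinEquiv_append, ← henc]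
  have hsum : (tupleIncidence n (k / 2) * spectralMatrix H p *
      (tupleIncidence n (k / 2)).transpose) f g =
      ∑ T, ∑ S, if Finset.univ.image f = S.1 ∧ Finset.univ.image g = T.1
        then spectralMatrix H p S T else 0 := by
    simp only [Matrix.mul_apply, Matrix.transpose_apply, tupleIncidence, Matrix.of_apply,
      Finset.sum_mul]
    refine Finset.sum_congr rfl fun T _ => Finset.sum_congr rfl fun S _ => ?_
    split_ifs <;> simp_all
  rw [hsum]
  by_cases hfg : (Finset.univ.image f).card = k / 2 ∧ (Finset.univ.image g).card = k / 2
  · obtain ⟨hf, hg⟩ := hfg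
    rw [Finset.sum_eq_single ⟨_, hg⟩, Finset.sum_eq_single ⟨_, hf⟩, if_pos ⟨rfl, rfl⟩]
    · by_cases hc : (Finset.univ.image v).card = k
      · rw [tupleWeight_of_card_eq H p v hc]
        exact (spectralMatrix_apply_of_union_eq H p himg.symm).symm
      · rw [tupleWeight_of_card_ne H p v hc, spectralMatrix_apply_of_not_disjoint hk]
        intro hd
        refine hc ?_
        rw [hv, himg]
        exact card_union_of_disjoint (S := ⟨_, hf⟩) (T := ⟨_, hg⟩) hk hd
    · exact fun S _ hS => if_neg fun h => hS (Subtype.ext h.1.symm)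
    · exact fun h => absurd (Finset.mem_univ _) h
    · exact fun T _ hT => Finset.sum_eq_zero fun S _ => if_neg fun h => hT (Subtype.ext h.2.symm)
    · exact fun h => absurd (Finset.mem_univ _) h
  · rw [tupleWeight_of_card_ne, Finset.sum_eq_zero fun T _ => Finset.sum_eq_zero fun S _ =>
      if_neg fun h => hfg ⟨by rw [h.1, S.2], by rw [h.2, T.2]⟩]
    intro hc
    rw [himg] at hc
    have h1 := Finset.card_union_le (Finset.univ.image f) (Finset.univ.image g)
    have h2 : (Finset.univ.image f).card ≤ k / 2 := Finset.card_image_le.trans_eq (by simp)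
    have h3 : (Finset.univ.image g).card ≤ k / 2 := Finset.card_image_le.trans_eq (by simp)
    omega

/-- The elimination meets a pivot that is not positive exactly for the candidates up to the
spectral bound. -/
theorem notRefuted_iff (hk : Even k) (hk2 : 2 ≤ k) (hkn : k ≤ n) (H : UHypergraph k n) {p : ℝ}
    (hp : p < 1) (L : ℕ) :
    NotRefuted k (n ^ (k / 2)) (((k / 2).factorial : ℝ) ^ 4 * (1 - p) ^ 2)
      ((k.factorial : ℝ) * (k : ℝ) ^ k) (tupleGram n k (edgeBit H) p) L ↔
      (L : ℝ) ≤ spectralBound H p := by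
  set h := k / 2 with hh
  set D := n ^ h with hD
  set α := ((h.factorial : ℝ) ^ 4 * (1 - p) ^ 2) * (L : ℝ) ^ k with hα
  set β := (k.factorial : ℝ) * (k : ℝ) ^ k with hβ
  have hk0 : (0 : ℝ) < k := by exact_mod_cast (by omega : 0 < k)
  have hβ0 : 0 < β := by positivity
  have hf0 : (0 : ℝ) < h.factorial := by positivity
  have hne : Nonempty (KSubset n h) := by
    obtain ⟨S, -, hS⟩ := Finset.exists_subset_card_eq
      (show h ≤ (Finset.univ : Finset (Fin n)).card by rw [Finset.card_univ, Fintype.card_fin]; omega)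
    exact ⟨⟨S, hS⟩⟩
  have hfact : (k.choose h : ℝ) * h.factorial ^ 2 = k.factorial := by
    have := Nat.choose_mul_factorial_mul_factorial (show h ≤ k by omega)
    obtain ⟨r, hr⟩ := hk
    rw [show k - h = h by omega, mul_assoc, ← sq] at this
    exact_mod_cast this
  rw [le_spectralBound_iff hk2 H hp]
  refine or_congr Iff.rfl ?_
  set G := tupleGram n k (edgeBit H) p with hG
  have hsymm : ∀ i l, (if i = l then α else 0) - β * G i l = (if l = i then α else 0) - β * G l i := by
    intro i l
    have : G i l = G l i := Finset.sum_congr rfl fun w _ => mul_comm _ _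
    rw [this]
    simp only [eq_comm]
  have h1 := posDefFrom_zero_iff D (M := fun i l => (if i = l then α else 0) - β * G i l) hsymm
  have h2 := blowUp_posDef_iff hf0 (tupleIncidence_transpose_mul_self n h) (spectralMatrix H p)
    (α := α) hβ0
  have h3 : PosDefFrom D 0 (fun i l => (if i = l then α else 0) - β * G i l) ↔
      ∀ x : (Fin h → Fin n) → ℝ, x ≠ 0 → 0 < α * ∑ f, x f ^ 2 - β * ∑ f,
        (Matrix.mulVec (tupleIncidence n h * spectralMatrix H p * (tupleIncidence n h).transpose) x)
          f ^ 2 := by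
    set B := tupleIncidence n h * spectralMatrix H p * (tupleIncidence n h).transpose with hB
    -- the quadratic form of a vector indexed by numbers is that of the vector indexed by tuples
    have hform : ∀ y : ℕ → ℝ, ∑ i ∈ Finset.Ico 0 D, ∑ l ∈ Finset.Ico 0 D,
        ((if i = l then α else 0) - β * G i l) * y i * y l =
        α * ∑ f : Fin h → Fin n, y (finFunctionFinEquiv f : ℕ) ^ 2 -
          β * ∑ f, (B.mulVec (fun g => y (finFunctionFinEquiv g : ℕ)) f) ^ 2 := by
      intro y
      have htr : ∀ F : ℕ → ℝ, ∑ i ∈ Finset.range D, F i =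
          ∑ f : Fin h → Fin n, F (finFunctionFinEquiv f : ℕ) := fun F => by
        rw [Finset.sum_range, ← (finFunctionFinEquiv (m := n) (n := h)).sum_comp]
      rw [← Finset.range_eq_Ico, hG]
      simp only [tupleGram]
      rw [quadraticForm_gram D α β
        (fun w i => tupleWeight n k (edgeBit H) p (n ^ (k / 2) * i + w)) y, htr, htr]
      congr 2
      refine Finset.sum_congr rfl fun f _ => ?_
      rw [htr]
      congr 1
      refine Finset.sum_congr rfl fun g _ => ?_
      rw [tupleWeight_eq_mul hk H p f g]
    constructor
    · intro hpd x hx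
      obtain ⟨f, hf⟩ := Function.ne_iff.1 hx
      set y : ℕ → ℝ := fun i => if hi : i < D then x (finFunctionFinEquiv.symm ⟨i, hi⟩) else 0
        with hy
      have hyx : ∀ f : Fin h → Fin n, y (finFunctionFinEquiv f : ℕ) = x f := by
        intro f
        simp only [hy]
        rw [dif_pos (finFunctionFinEquiv f).2]
        exact congrArg x (finFunctionFinEquiv.symm_apply_apply f)
      have := hpd y ⟨(finFunctionFinEquiv f : ℕ), Nat.zero_le _, (finFunctionFinEquiv f).2, by
        rw [hyx]; exact hf⟩
      rw [hform] at this
      simpa only [hyx] using this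
    · rintro hall y ⟨i, -, hi, hyi⟩
      rw [hform]
      refine hall _ fun h0 => hyi ?_
      have := congrFun h0 (finFunctionFinEquiv.symm ⟨i, hi⟩)
      simpa using this
  have h4 : (∃ j < D, eliminated (fun i l => (if i = l then α else 0) - β * G i l) j j j ≤ 0) ↔
      α ≤ β * (h.factorial : ℝ) ^ 2 * spectralNorm H p ^ 2 := by
    rw [← not_iff_not, not_le]
    refine Iff.trans ?_ ((h1.symm.trans h3).trans h2)
    push Not
    rfl
  have e1 : α = (h.factorial : ℝ) ^ 4 * ((L : ℝ) ^ k * (1 - p) ^ 2) := by rw [hα]; ring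
  have e2 : β * (h.factorial : ℝ) ^ 2 * spectralNorm H p ^ 2 =
      (h.factorial : ℝ) ^ 4 * ((k : ℝ) ^ k * k.choose h * spectralNorm H p ^ 2) := by
    rw [hβ, ← hfact]; ring
  rw [h4, e1, e2, mul_le_mul_iff_right₀ (by positivity)]

theorem algOutput_eq_of_isGreatest (H : UHypergraph k n) {p : ℝ} (hp : p < 1) {a : ℕ}
    (ha : IsGreatest {L : ℕ | L ≤ n ∧ (L : ℝ) ≤ spectralBound H p} a) :
    a = algOutput H p := by
  rw [algOutput, if_neg hp.ne]
  have h0 : 0 ≤ spectralBound H p := (Nat.cast_nonneg a).trans ha.1.2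
  refine le_antisymm (le_min ha.1.1 (Nat.le_floor ha.1.2)) (ha.2 ⟨min_le_left _ _, ?_⟩)
  exact le_trans (by exact_mod_cast min_le_right _ _) (Nat.floor_le h0)

/-- The program also halts within the time bound if `n = 1`, where the bound does not depend on `k`:
then `n < k`, and the program stops at once. -/
theorem program_correct (hk : Even k) (hk2 : 2 ≤ k) (hn : 1 ≤ n) (p : unitInterval)
    (H : UHypergraph k n) :
    Achieves program (inputState H (p : ℝ)) (400 * n ^ (400 * k)) fun m =>
      m.nat 0 = algOutput H (p : ℝ) := by
  refine Achieves.weaken (T := 2 + ((300 * (n ^ k) ^ 4 + 1 + 1) + 1)) ?_ ?_ fun _ _ h => h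
  swap
  · have h1 : (n ^ k) ^ 4 ≤ n ^ (400 * k) := by
      rw [← pow_mul]
      exact Nat.pow_le_pow_right hn (by omega)
    have h2 : 1 ≤ n ^ (400 * k) := Nat.one_le_pow _ _ hn
    omega
  refine Achieves.seq (T := 2) (R := fun m => m.nat 2 = 1 ∧ m.real 1 = 1)
    (Achieves.block (by simp) rfl (by simp)) fun m hF ⟨h2, hr1⟩ => ?_
  have h0 : m.nat 0 = n := by rw [hF.nat 0]; rfl
  have h1 : m.nat 1 = k := by rw [hF.nat 1]; rfl
  have h3 : m.nat 3 = 0 := by rw [hF.nat 3]; rfl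
  have hp : m.real 0 = p := by rw [hF.real 0]; rfl
  have h21 : m.real 21 = 0 := by rw [hF.real 21]; rfl
  have hbits : m.natArr 0 = edgeBit H := by rw [hF.natArr 0]; rfl
  refine Achieves.ite (fun hb => ?_) fun hb => ?_
  · simp only [Test.Holds, h0, h1] at hb
    refine (Achieves.skip ?_).weaken (by omega) fun _ _ h => h
    rw [show (m.setNat 98 0).nat 0 = n by simp [h0]]
    refine le_antisymm ?_ (algOutput_le H _)
    rw [algOutput]
    split_ifs
    · exact le_rfl
    · refine le_min le_rfl (Nat.le_floor (le_trans ?_ (le_max_left _ _)))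
      rw [le_sub_iff_add_le]
      exact_mod_cast hb
  · simp only [Test.Holds, h0, h1, not_lt] at hb
    refine Achieves.ite (fun hb' => ?_) fun hb' => ?_
    · simp only [Test.Holds, hp, hr1] at hb'
      refine (achieves_mainProgram h0 h1 hk hk2 hb h2 h3 hp h21).weaken (by omega) fun m' _ hgr => ?_
      rw [hbits] at hgr
      refine algOutput_eq_of_isGreatest H hb' ?_
      simpa only [notRefuted_iff hk hk2 hb H hb'] using hgr
    · simp only [Test.Holds, hp, hr1] at hb'
      have hp1 : (p : ℝ) = 1 := le_antisymm p.2.2 (not_lt.1 hb')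
      refine (Achieves.skip ?_).weaken (by omega) fun _ _ h => h
      simp [h0, algOutput, hp1]

end Tuples
end CliqueCert

/-- One program, one exponent constant `a` and one constant `K` serve all `k`, `n` and `p`.
The program computes `algOutput` (left in natural variable `0`) in `n ^ O(k)` steps. -/
theorem lemma3 :
    ∃ (prog : CliqueCert.Program) (a : ℕ) (K : ℝ),
      ∀ k : ℕ, Even k → 2 ≤ k → ∀ n : ℕ, 1 ≤ n → ∀ p : unitInterval,
        (∀ H : CliqueCert.UHypergraph k n,
          (∃ (t : ℕ) (m : CliqueCert.State),
            CliqueCert.Runs prog (CliqueCert.inputState H (p : ℝ)) t m ∧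
            t ≤ a * n ^ (a * k) ∧
            m.nat 0 = CliqueCert.algOutput H (p : ℝ)) ∧
          CliqueCert.cliqueNumber H ≤ CliqueCert.algOutput H (p : ℝ) ∧
          CliqueCert.algOutput H (p : ℝ) ≤ n ∧
          ((p : ℝ) < 1 →
            (CliqueCert.cliqueNumber H : ℝ) ≤ CliqueCert.spectralBound H (p : ℝ))) ∧
        ((p : ℝ) < 1 → ∀ c : ℝ, 1 ≤ c →
          1 - (n : ℝ) ^ (-c) ≤
            (CliqueCert.randomHypergraph k n p).real
              {H | (CliqueCert.algOutput H (p : ℝ) : ℝ) ≤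
                    K * k * (c * Real.log n / (1 - p)) ^ (2 / (k : ℝ)) * √(n : ℝ) ∧
                  CliqueCert.spectralBound H (p : ℝ) ≤
                    K * k * (c * Real.log n / (1 - p)) ^ (2 / (k : ℝ)) * √(n : ℝ)}) := by
  refine ⟨CliqueCert.program, 400, 56, fun k hk hk2 n hn p => ⟨fun H => ⟨?_, ?_, ?_, ?_⟩, ?_⟩⟩
  · exact CliqueCert.program_correct hk hk2 hn p H
  · exact CliqueCert.cliqueNumber_le_algOutput hk hk2 H p
  · exact CliqueCert.algOutput_le H _
  · exact CliqueCert.cliqueNumber_le_spectralBound hk hk2 H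
  · exact fun hp c hc => CliqueCert.high_probability_bound hk hk2 hn p hp hc
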